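/- Fix $q_1\ge 1$ and let $r=q_1(q_1+1)/2+1$. For $\psi\in\mathbb{R}^r$ let $\Psi_1(\psi)$ be the symmetric $q_1\times q_1$ matrix whose half-vectorization is $\psi_{-r}=(\psi_1,\dots,\psi_{r-1})$, and let $\mathbb{P}=\{\psi\in\mathbb{R}^r:\Psi_1(\psi)\succeq 0,\ \psi_r>0\}$. For every $m\in\{1,2,\dots\}$ suppose that, independently for $i=1,\dots,m$, $$Y_i=X_i\beta_m+Z_iU_i+E_i,\qquad U_i\sim \mathrm{N}(0,\Psi_1(\psi)),\quad E_i\sim \mathrm{N}(0,\psi_rI_{n_i}),$$ with $U_i$ and $E_i$ independent, where $X_i\in\mathbb{R}^{n_i\times p_m}$, $Z_i\in\mathbb{R}^{n_i\times q_1}$ are non-stochastic, $\beta_m\in\mathbb{R}^{p_m}$, and $n_i$, $X_i$, $Z_i$, $p_m$, $\beta_m$ may depend on $m$. Write $n=\sum_{i=1}^m n_i$, $\bar n=n/m$, let $Y\in\mathbb{R}^n$ and $X\in\mathbb{R}^{n\times p_m}$ be obtained by stacking the $Y_i$ and the $X_i$, let $Z=\mathrm{bdiag}(Z_1,\dots,Z_m)$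 and $\Sigma(\psi)=Z(I_m\otimes\Psi_1(\psi))Z^{\mathrm T}+\psi_rI_n$. Assume that there are constants $c_1,c_2\in(1,\infty)$, not depending on $m$, such that (i) $\bar n/q_1\ge c_1$ for every $m$; (ii) all eigenvalues of $Z_i^{\mathrm T}Z_i$ lie in $[c_2^{-1},c_2]$, for every $m$ and every $i\le m$; (iii') $p_m/m\to0$ as $m\to\infty$; (iv) $X$ has full column rank $p_m$ for every $m$. Let $V\in\mathbb{R}^{n\times(n-p_m)}$ satisfy $V^{\mathrm T}V=I$ and $V^{\mathrm T}X=0$, let $\tilde Y=V^{\mathrm T}Y$ and $\tilde\Sigma(\psi)=V^{\mathrm T}\Sigma(\psi)V$, let $$\tilde\ell(\psi)=-\tfrac12\{\log|\tilde\Sigma(\psi)|+\tilde Y^{\mathrm T}\tilde\Sigma(\psi)^{-1}\tilde Y\}$$ be the restricted log-likelihood, $\tilde S(\psi)=\partial\tilde\ell(\psi)/\partial\psi$ the restricted score, $\tilde{\mathcal I}(\psi)=\mathrm{cov}_\psi\{\tilde S(\psi)\}$ the restricted information, and $\tilde T^S(\psi)=\Vert\tilde{\mathcal I}(\psi)^{-1/2}\tilde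 S(\psi)\Vert^2$. For $\alpha\in(0,1)$ let $c_{r,1-\alpha}$ be the $(1-\alpha)$th quantile of the $\chi^2_r$ distribution and $$\tilde{\mathbb{C}}^S_m(\alpha)=\{\psi\in\mathbb{P}:\tilde T^S(\psi)\le c_{r,1-\alpha}\}.$$ Then for every $\alpha\in(0,1)$ and every compact set $\mathbb{A}\subseteq\mathbb{P}$ (which may contain boundary points of $\mathbb{P}$), $$\lim_{m\to\infty}\ \sup_{\psi\in\mathbb{A}}\bigl|\mathrm{P}_\psi\{\psi\in\tilde{\mathbb{C}}^S_m(\alpha)\}-(1-\alpha)\bigr|=0.$$ -/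

import Mathlib

open MeasureTheory ProbabilityTheory Filter Topology Matrix
open scoped MatrixOrder

noncomputable section

namespace ClusterMixed

/-! ### Parameters -/

/-- Index set of the covariance parameter `ψ`: unordered pairs `s(a, b)` index the distinct entries
of the symmetric `q × q` matrix `Ψ₁` (its half-vectorization `ψ₋ᵣ`), and `none` indexes the error
variance `ψᵣ`. -/
abbrev ParamIndex (q : ℕ) : Type := Option (Sym2 (Fin q))

/-- The dimension of `ψ`, `r = q (q + 1) / 2 + 1`. -/
def paramDim (q : ℕ) : ℕ := q * (q + 1) / 2 + 1

theorem card_paramIndex (q : ℕ) : Fintype.card (ParamIndex q) = paramDim q := by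
  simp [ParamIndex, paramDim, Sym2.card, Nat.choose_two_right, Nat.mul_comm]

/-- The space `ℝʳ` of covariance parameters. -/
abbrev Param (q : ℕ) : Type := EuclideanSpace ℝ (ParamIndex q)

/-- The symmetric matrix `Ψ₁(ψ)` whose half-vectorization is `ψ₋ᵣ`. -/
def Psi1 {q : ℕ} (ψ : Param q) : Matrix (Fin q) (Fin q) ℝ :=
  Matrix.of fun a b => ψ (some s(a, b))

/-- The error variance `ψᵣ`. -/
def errVar {q : ℕ} (ψ : Param q) : ℝ := ψ none

/-- The parameter set: `Ψ₁(ψ)` positive semi-definite and `ψᵣ > 0`. -/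
def paramSet (q : ℕ) : Set (Param q) := {ψ | (Psi1 ψ).PosSemidef ∧ 0 < errVar ψ}

/-! ### The mixed model with `m` independent clusters -/

/-- The non-stochastic quantities of the model `Yᵢ = Xᵢ β + Zᵢ Uᵢ + Eᵢ`, `i = 1, …, m`. -/
structure ClusterDesign (m q : ℕ) where
  /-- number of fixed effects -/
  p : ℕ
  /-- cluster sizes -/
  size : Fin m → ℕ
  /-- fixed effect design matrices -/
  X : ∀ i, Matrix (Fin (size i)) (Fin p) ℝ
  /-- random effect design matrices -/
  Z : ∀ i, Matrix (Fin (size i)) (Fin q) ℝ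

namespace ClusterDesign

variable {m q : ℕ} (D : ClusterDesign m q)

/-- Index set of the observations (cluster, position within the cluster). -/
abbrev Obs : Type := Σ i : Fin m, Fin (D.size i)

/-- The total number of observations `n = ∑ᵢ nᵢ`. -/
def n : ℕ := ∑ i, D.size i

/-- The average cluster size `n / m`. -/
def avgSize : ℝ := (D.n : ℝ) / (m : ℝ)

/-- The stacked `n × p` matrix `X`. -/
def stackX : Matrix D.Obs (Fin D.p) ℝ := Matrix.of fun o a => D.X o.1 o.2 a

/-- The block-diagonal matrix `Z = bdiag(Z₁, …, Zₘ)`. -/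
def bigZ : Matrix D.Obs (Σ _ : Fin m, Fin q) ℝ := Matrix.blockDiagonal' D.Z

/-- `Σ(ψ) = Z (Iₘ ⊗ Ψ₁(ψ)) Zᵀ + ψᵣ Iₙ`. -/
def Sig (ψ : Param q) : Matrix D.Obs D.Obs ℝ :=
  D.bigZ * Matrix.blockDiagonal' (fun _ : Fin m => Psi1 ψ) * D.bigZᵀ + errVar ψ • 1

/-- The joint law of `((Uᵢ)ᵢ, (Eᵢ)ᵢ)` at `ψ`: all vectors independent, `Uᵢ ∼ N(0, Ψ₁(ψ))` and
`Eᵢ ∼ N(0, ψᵣ I)`. -/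
def effectsLaw (ψ : Param q) :
    Measure ((Fin m → EuclideanSpace ℝ (Fin q)) × (∀ i, EuclideanSpace ℝ (Fin (D.size i)))) :=
  (Measure.pi fun _ : Fin m => multivariateGaussian 0 (Psi1 ψ)).prod
    (Measure.pi fun i : Fin m =>
      multivariateGaussian 0 (errVar ψ • (1 : Matrix (Fin (D.size i)) (Fin (D.size i)) ℝ)))

/-- The stacked response vector with blocks `Yᵢ = Xᵢ β + Zᵢ Uᵢ + Eᵢ`. -/
def response (β : Fin D.p → ℝ)
    (ω : (Fin m → EuclideanSpace ℝ (Fin q)) × (∀ i, EuclideanSpace ℝ (Fin (D.size i)))) :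
    D.Obs → ℝ :=
  fun o => (D.X o.1 *ᵥ β) o.2 + (D.Z o.1 *ᵥ (ω.1 o.1).ofLp) o.2 + ω.2 o.1 o.2

/-- The distribution of `Y` under the parameter `(β, ψ)`. -/
def responseLaw (β : Fin D.p → ℝ) (ψ : Param q) : Measure (D.Obs → ℝ) :=
  (D.effectsLaw ψ).map (D.response β)

end ClusterDesign

/-! ### Score statistics of a centred Gaussian model `y ∼ N(0, S(ψ))` -/

section Gaussian

variable {q : ℕ} {κ : Type*} [Fintype κ] [DecidableEq κ]

/-- The log-likelihood (up to a constant) of the model `y ∼ N(0, S(ψ))`. -/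
def logLik (S : Param q → Matrix κ κ ℝ) (ψ : Param q) (y : κ → ℝ) : ℝ :=
  -(1 / 2) * (Real.log (S ψ).det + y ⬝ᵥ ((S ψ)⁻¹ *ᵥ y))

/-- The score: the vector of partial derivatives of the log-likelihood at `ψ`. -/
def score (S : Param q → Matrix κ κ ℝ) (ψ : Param q) (y : κ → ℝ) : ParamIndex q → ℝ :=
  fun j => lineDeriv ℝ (fun φ : Param q => logLik S φ y) ψ (EuclideanSpace.single j 1)

/-- The Fisher information: the covariance matrix of the score at `ψ` when `y ∼ N(0, S(ψ))`. -/
def fisherInfo (S : Param q → Matrix κ κ ℝ) (ψ : Param q) :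
    Matrix (ParamIndex q) (ParamIndex q) ℝ :=
  Matrix.of fun i j =>
    cov[fun y : EuclideanSpace ℝ κ => score S ψ y.ofLp i,
      fun y : EuclideanSpace ℝ κ => score S ψ y.ofLp j; multivariateGaussian 0 (S ψ)]

/-- The standardized score `W(ψ) = I(ψ)^{-1/2} S(ψ)`. -/
def stdScore (S : Param q → Matrix κ κ ℝ) (ψ : Param q) (y : κ → ℝ) : Param q :=
  WithLp.toLp 2 ((CFC.sqrt (fisherInfo S ψ))⁻¹ *ᵥ score S ψ y)

/-- The score test-statistic `T(ψ) = ‖W(ψ)‖²` (Euclidean norm). -/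
def scoreStat (S : Param q → Matrix κ κ ℝ) (ψ : Param q) (y : κ → ℝ) : ℝ :=
  ‖stdScore S ψ y‖ ^ 2

end Gaussian

/-! ### Chi-squared quantiles -/

/-- The chi-squared distribution with `r` degrees of freedom: the law of the squared Euclidean norm
of a standard normal vector in `ℝʳ`. -/
def chiSq (r : ℕ) : Measure ℝ :=
  (stdGaussian (EuclideanSpace ℝ (Fin r))).map fun x => ‖x‖ ^ 2

/-- The `u`-th quantile of the chi-squared distribution with `r` degrees of freedom. -/
def chiSqQuantile (r : ℕ) (u : ℝ) : ℝ := sInf {t : ℝ | u ≤ cdf (chiSq r) t}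

/-! ### The restricted score confidence region -/

namespace ClusterDesign

variable {m q : ℕ} (D : ClusterDesign m q)

/-- `V` is an `n × (n - p)` semi-orthogonal matrix with `Vᵀ X = 0`. -/
def IsRestriction (V : Matrix D.Obs (Fin (D.n - D.p)) ℝ) : Prop :=
  Vᵀ * V = 1 ∧ Vᵀ * D.stackX = 0

/-- The covariance matrix `Vᵀ Σ(ψ) V` of the restricted data `Vᵀ Y`. -/
def restrictedSig (V : Matrix D.Obs (Fin (D.n - D.p)) ℝ) (ψ : Param q) :
    Matrix (Fin (D.n - D.p)) (Fin (D.n - D.p)) ℝ :=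
  Vᵀ * D.Sig ψ * V

/-- The restricted score statistic at `ψ` for the response `y`: the score statistic of the model
`Vᵀ Y ∼ N(0, Vᵀ Σ(ψ) V)`. -/
def restrictedScoreStat (V : Matrix D.Obs (Fin (D.n - D.p)) ℝ) (ψ : Param q) (y : D.Obs → ℝ) : ℝ :=
  scoreStat (D.restrictedSig V) ψ (Vᵀ *ᵥ y)

/-- The restricted score confidence region with nominal level `1 - α`. -/
def restrictedRegion (V : Matrix D.Obs (Fin (D.n - D.p)) ℝ) (α : ℝ) (y : D.Obs → ℝ) :
    Set (Param q) :=
  {ψ ∈ paramSet q | D.restrictedScoreStat V ψ y ≤ chiSqQuantile (paramDim q) (1 - α)}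

/-- The coverage probability of the restricted score confidence region at `(β, ψ)`. -/
def coverage (V : Matrix D.Obs (Fin (D.n - D.p)) ℝ) (α : ℝ) (β : Fin D.p → ℝ) (ψ : Param q) : ℝ :=
  (D.responseLaw β ψ).real {y | ψ ∈ D.restrictedRegion V α y}

end ClusterDesign

end ClusterMixed

end

open ClusterMixed

namespace ClusterMixed

/-! ### Products of characteristic functions -/

/-! A supremum over `A` is almost attained at some `ψ` for each `m`, so it suffices to prove
convergence of the coverage along an arbitrary sequence in `A`. Since `VᵀX = 0`, the restricted data
are `N(0, VᵀΣ(ψ)V)`, free of `β` (`map_responseLaw`), and this covariance is linear in `ψ`.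

Fix a direction `v`. Simultaneous diagonalization of the restricted covariances at `ψ` and at `v`
turns the directional score into `∑ (l k / 2)(z k ^ 2 - 1)` with independent standard normal `z k`.
The characteristic function of the standardized score at `t` is that of the directional score with
`v = I(ψ)^{-1/2} t`, whose variance is exactly `‖t‖²`. By the Lindeberg bound
`norm_prod_charFun_sub_exp_le`, normality follows once the largest `|l k|` tends to zero.

Two estimates give this. First, `|l k| ≤ L‖v‖ / s`, where `s` bounds the error variance below
(`abs_diag_le_of_congr`). Second, `‖v‖` is small because the information grows like `m`: it controls
the squared Frobenius norm of the restricted covariance in direction `v`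
(`trace_mul_self_le_of_congr`). Before restriction that squared norm is at least a constant times
`m‖v‖²` (`le_trace_Sig_sq`), and restriction costs at most `2L²p‖v‖²` (`le_trace_compression_sq`),
which is negligible as `p/m → 0`.

Singular `Ψ₁(ψ)` causes no trouble: only the error variance must stay away from zero, which
compactness ensures. Lévy's theorem and the absence of mass on spheres finish the proof. -/

theorem norm_prod_sub_prod_le_sum {ι : Type*} (s : Finset ι) (f g : ι → ℂ)
    (hf : ∀ i, ‖f i‖ ≤ 1) (hg : ∀ i, ‖g i‖ ≤ 1) :
    ‖∏ i ∈ s, f i - ∏ i ∈ s, g i‖ ≤ ∑ i ∈ s, ‖f i - g i‖ := by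
  classical
  induction s using Finset.induction_on with
  | empty => simp
  | insert a s ha ih =>
    rw [Finset.prod_insert ha, Finset.prod_insert ha, Finset.sum_insert ha]
    have h1 : f a * ∏ i ∈ s, f i - g a * ∏ i ∈ s, g i
        = (f a - g a) * ∏ i ∈ s, f i + g a * (∏ i ∈ s, f i - ∏ i ∈ s, g i) := by ring
    have h2 : ‖∏ i ∈ s, f i‖ ≤ 1 := by
      rw [norm_prod]
      exact Finset.prod_le_one (fun _ _ => norm_nonneg _) (fun i _ => hf i)
    rw [h1]
    refine (norm_add_le _ _).trans (add_le_add ?_ ?_)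
    · rw [norm_mul]
      exact mul_le_of_le_one_right (norm_nonneg _) h2
    · rw [norm_mul]
      exact (mul_le_of_le_one_left (norm_nonneg _) (hg a)).trans ih

/-- This is the second-order expansion of a standardized characteristic function, applied to the
standard normal law itself. -/
theorem exp_neg_sq_div_two_sub_isLittleO :
    (fun t : ℝ => Complex.exp (-(t : ℂ) ^ 2 / 2) - (1 - (t : ℂ) ^ 2 / 2)) =o[𝓝 0]
      fun t : ℝ => t ^ 2 := by
  have h := taylor_charFun_two (P := gaussianReal 0 1) (X := id) (by fun_prop)
    (by simp) (by
      have h := variance_of_integral_eq_zero (μ := gaussianReal 0 1) (X := id) (by fun_prop)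
        (by simp)
      have h2 := variance_id_gaussianReal (μ := 0) (v := 1)
      rw [h] at h2
      simpa using h2)
  rw [Measure.map_id] at h
  refine h.congr_left fun t => ?_
  rw [charFun_gaussianReal]
  congr 2
  push_cast
  ring

/-- A quantitative Lindeberg central limit theorem for weighted sums of independent copies of a
standardized random variable, in terms of characteristic functions. -/
theorem norm_prod_charFun_sub_exp_le {Ω : Type*} {mΩ : MeasurableSpace Ω} {P : Measure Ω}
    [IsProbabilityMeasure P] {X : Ω → ℝ} (hX : AEMeasurable X P) (h0 : P[X] = 0)
    (h1 : P[X ^ 2] = 1) {ε : ℝ} (hε : 0 < ε) :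
    ∃ δ > 0, ∀ (n : ℕ) (a : Fin n → ℝ), (∀ k, |a k| ≤ δ) →
      ‖∏ k, charFun (P.map X) (a k) - Complex.exp (-((∑ k, a k ^ 2 : ℝ) : ℂ) / 2)‖
        ≤ ε * ∑ k, a k ^ 2 := by
  -- Both characteristic functions are `1 - t²/2 + o(t²)`, so they differ by `o(t²)`; the estimate
  -- is then summed over the factors.
  have h := (taylor_charFun_two hX h0 h1).sub exp_neg_sq_div_two_sub_isLittleO
  have h' := h.def hε
  rw [Metric.eventually_nhds_iff] at h'
  obtain ⟨δ, hδ, h'⟩ := h'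
  refine ⟨δ / 2, by positivity, fun n a ha => ?_⟩
  have : IsProbabilityMeasure (P.map X) := Measure.isProbabilityMeasure_map hX
  have hexp : Complex.exp (-((∑ k, a k ^ 2 : ℝ) : ℂ) / 2)
      = ∏ k, Complex.exp (-(a k : ℂ) ^ 2 / 2) := by
    rw [← Complex.exp_sum]
    congr 1
    push_cast
    rw [neg_div, Finset.sum_div, ← Finset.sum_neg_distrib]
    exact Finset.sum_congr rfl fun k _ => by ring
  rw [hexp, Finset.mul_sum]
  refine (norm_prod_sub_prod_le_sum _ _ _ (fun k => norm_charFun_le_one _) fun k => ?_).trans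
    (Finset.sum_le_sum fun k _ => ?_)
  · rw [Complex.norm_exp]
    have : (-(a k : ℂ) ^ 2 / 2).re = -(a k) ^ 2 / 2 := by
      rw [show (-(a k : ℂ) ^ 2 / 2) = ((-(a k) ^ 2 / 2 : ℝ) : ℂ) by push_cast; rfl,
        Complex.ofReal_re]
    rw [this, Real.exp_le_one_iff]
    nlinarith [sq_nonneg (a k)]
  · have h3 := @h' (a k) (by
      rw [dist_zero_right, Real.norm_eq_abs]
      exact (ha k).trans_lt (by linarith))
    simpa using h3

/-! ### Chi-squared quantiles -/

/-- Fubini: once all coordinates but the last are fixed, at most two values of the last one put the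
point on the sphere, and a Gaussian law has no atoms. -/
theorem stdGaussian_sphere_eq_zero (k : ℕ) (c : ℝ) :
    stdGaussian (EuclideanSpace ℝ (Fin (k + 1))) {x | ‖x‖ ^ 2 = c} = 0 := by
  have hms : MeasurableSet {x : EuclideanSpace ℝ (Fin (k + 1)) | ‖x‖ ^ 2 = c} :=
    (isClosed_eq (by fun_prop) continuous_const).measurableSet
  rw [← map_pi_eq_stdGaussian, Measure.map_apply (by fun_prop) hms]
  have mp := (measurePreserving_piFinSuccAbove (fun _ : Fin (k + 1) => gaussianReal 0 1)
    (Fin.last k)).symm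
  rw [← mp.measure_preimage (hms.preimage (by fun_prop)).nullMeasurableSet]
  have hsw := Measure.measurePreserving_swap (μ := Measure.pi (fun _ : Fin k => gaussianReal 0 1))
    (ν := gaussianReal 0 1)
  have hm2 := (hms.preimage (f := WithLp.toLp 2) (by fun_prop)).preimage mp.measurable
  rw [← hsw.measure_preimage hm2.nullMeasurableSet,
    Measure.measure_prod_null (hm2.preimage measurable_swap)]
  refine Eventually.of_forall fun y => ?_
  have := nullSingletonClass_gaussianReal (μ := 0) (v := 1) one_ne_zero
  refine Set.Finite.measure_zero (Set.Finite.subset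
    (s := {√(c - ∑ i, y i ^ 2), -√(c - ∑ i, y i ^ 2)}) (by simp) ?_) _
  intro t ht
  simp only [Set.mem_preimage, Set.mem_ofPred_eq, Prod.swap_prod_mk, EuclideanSpace.real_norm_sq_eq,
    Fin.sum_univ_castSucc] at ht
  have e1 : ∀ i : Fin k, (MeasurableEquiv.piFinSuccAbove (fun _ : Fin (k + 1) => ℝ)
      (Fin.last k)).symm (t, y) (Fin.castSucc i) = y i := by
    intro i
    simp [MeasurableEquiv.piFinSuccAbove]
  have e2 : (MeasurableEquiv.piFinSuccAbove (fun _ : Fin (k + 1) => ℝ)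
      (Fin.last k)).symm (t, y) (Fin.last k) = t := by
    simp [MeasurableEquiv.piFinSuccAbove]
  simp only [e1, e2] at ht
  have h3 : c - ∑ i, y i ^ 2 = t ^ 2 := by linarith
  rw [h3, Real.sqrt_sq_eq_abs]
  rcases abs_choice t with h | h <;> simp [h]

instance isProbabilityMeasure_chiSq (r : ℕ) : IsProbabilityMeasure (chiSq r) :=
  Measure.isProbabilityMeasure_map (by fun_prop)

theorem chiSq_singleton (k : ℕ) (c : ℝ) : chiSq (k + 1) {c} = 0 := by
  rw [chiSq, Measure.map_apply (by fun_prop) (measurableSet_singleton c)]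
  exact stdGaussian_sphere_eq_zero k c

theorem continuous_cdf_of_forall_singleton {μ : Measure ℝ} [IsProbabilityMeasure μ]
    (h : ∀ c, μ {c} = 0) : Continuous (cdf μ) := by
  refine continuous_iff_continuousAt.2 fun x => ?_
  rw [(monotone_cdf μ).continuousAt_iff_leftLim_eq_rightLim, StieltjesFunction.rightLim_eq]
  have h1 := h x
  rw [← measure_cdf μ, StieltjesFunction.measure_singleton, ENNReal.ofReal_eq_zero] at h1
  exact le_antisymm ((monotone_cdf μ).leftLim_le le_rfl) (by linarith)

/-- Without atoms the distribution function is continuous, so the infimum is attained. A value above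
`u` there would persist slightly to the left, contradicting minimality. -/
theorem cdf_sInf_eq {μ : Measure ℝ} [IsProbabilityMeasure μ] (h : ∀ c, μ {c} = 0) {u : ℝ}
    (hu : u ∈ Set.Ioo (0 : ℝ) 1) : cdf μ (sInf {t : ℝ | u ≤ cdf μ t}) = u := by
  have hc := continuous_cdf_of_forall_singleton h
  obtain ⟨t₁, ht₁⟩ := ((tendsto_cdf_atTop μ).eventually (lt_mem_nhds hu.2)).exists
  obtain ⟨t₀, ht₀⟩ := ((tendsto_cdf_atBot μ).eventually (gt_mem_nhds hu.1)).exists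
  have hbdd : BddBelow {t : ℝ | u ≤ cdf μ t} := by
    refine ⟨t₀, fun t ht => ?_⟩
    by_contra! hlt
    exact absurd ((monotone_cdf μ) hlt.le) (not_le.2 (ht₀.trans_le ht))
  have hmem : sInf {t : ℝ | u ≤ cdf μ t} ∈ {t : ℝ | u ≤ cdf μ t} :=
    (isClosed_le continuous_const hc).csInf_mem ⟨t₁, ht₁.le⟩ hbdd
  refine le_antisymm ?_ hmem
  by_contra! hlt
  have hev := (hc.tendsto (sInf {t : ℝ | u ≤ cdf μ t})).eventually (lt_mem_nhds hlt)
  obtain ⟨t, ht, ht'⟩ := ((hev.filter_mono nhdsWithin_le_nhds).and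
    (self_mem_nhdsWithin (s := Set.Iio (sInf {t : ℝ | u ≤ cdf μ t})))).exists
  exact absurd (csInf_le hbdd (show t ∈ {t : ℝ | u ≤ cdf μ t} from ht.le)) (not_le.2 ht')

theorem stdGaussian_param_map_norm_sq (q : ℕ) :
    (stdGaussian (Param q)).map (fun x => ‖x‖ ^ 2) = chiSq (paramDim q) := by
  have e : ParamIndex q ≃ Fin (paramDim q) :=
    Fintype.equivFinOfCardEq (card_paramIndex q)
  rw [chiSq, ← stdGaussian_map (LinearIsometryEquiv.piLpCongrLeft 2 ℝ ℝ e),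
    Measure.map_map (by fun_prop) (by fun_prop)]
  congr 1
  ext x
  simp

/-- Weak convergence to the standard normal law implies convergence of the probabilities of the
chi-squared balls. -/
theorem tendsto_measureReal_normSq_le_quantile {q : ℕ} {α : ℝ} (hα : α ∈ Set.Ioo (0 : ℝ) 1)
    (μ : ℕ → Measure (Param q)) (hμ : ∀ m, IsProbabilityMeasure (μ m))
    (h : ∀ t : Param q, Tendsto (fun m => charFun (μ m) t) atTop
      (𝓝 (Complex.exp (-‖t‖ ^ 2 / 2)))) :
    Tendsto (fun m => (μ m).real {w | ‖w‖ ^ 2 ≤ chiSqQuantile (paramDim q) (1 - α)}) atTop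
      (𝓝 (1 - α)) := by
  set c := chiSqQuantile (paramDim q) (1 - α)
  have hpd : paramDim q = q * (q + 1) / 2 + 1 := rfl
  let ν : ℕ → ProbabilityMeasure (Param q) := fun m => ⟨μ m, hμ m⟩
  let ν₀ : ProbabilityMeasure (Param q) := ⟨stdGaussian (Param q), inferInstance⟩
  have hν : Tendsto ν atTop (𝓝 ν₀) := by
    refine ProbabilityMeasure.tendsto_iff_tendsto_charFun.2 fun t => ?_
    simpa [ν, ν₀, charFun_stdGaussian] using h t
  have hmeas : ∀ s : Set ℝ, MeasurableSet s → stdGaussian (Param q) {w | ‖w‖ ^ 2 ∈ s}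
      = chiSq (paramDim q) s := by
    intro s hs
    rw [← stdGaussian_param_map_norm_sq, Measure.map_apply (by fun_prop) hs]
    rfl
  have hfr : (ν₀ : Measure (Param q)) (frontier {w | ‖w‖ ^ 2 ≤ c}) = 0 := by
    refine measure_mono_null (frontier_le_subset_eq (by fun_prop) continuous_const) ?_
    have := hmeas {c} (measurableSet_singleton c)
    rw [hpd, chiSq_singleton] at this
    exact this
  have h1 := ProbabilityMeasure.tendsto_measure_of_null_frontier_of_tendsto' hν hfr
  have h2 : (ν₀ : Measure (Param q)) {w | ‖w‖ ^ 2 ≤ c} = ENNReal.ofReal (1 - α) := by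
    have h3 := hmeas (Set.Iic c) measurableSet_Iic
    refine h3.trans ?_
    rw [← ofReal_cdf]
    congr 1
    exact cdf_sInf_eq (fun x => chiSq_singleton _ x) ⟨by linarith [hα.2], by linarith [hα.1]⟩
  rw [h2] at h1
  have h4 := (ENNReal.tendsto_toReal ENNReal.ofReal_ne_top).comp h1
  rw [ENNReal.toReal_ofReal (by linarith [hα.2])] at h4
  exact h4

/-! ### Traces, quadratic forms and simultaneous diagonalization -/

section Trace

variable {ι κ : Type*} [Fintype ι] [Fintype κ]

theorem trace_transpose_mul_mul (G : Matrix ι ι ℝ) (N : Matrix ι κ ℝ) :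
    (Nᵀ * G * N).trace = ∑ k, N.col k ⬝ᵥ G *ᵥ N.col k := by
  simp only [trace, diag_apply, Matrix.mul_assoc]
  rfl

theorem trace_transpose_mul_self (N : Matrix ι κ ℝ) :
    (Nᵀ * N).trace = ∑ k, N.col k ⬝ᵥ N.col k := rfl

theorem trace_transpose_mul_self_nonneg (N : Matrix ι κ ℝ) : 0 ≤ (Nᵀ * N).trace := by
  rw [trace_transpose_mul_self]
  exact Finset.sum_nonneg fun k _ => Finset.sum_nonneg fun i _ => mul_self_nonneg _

theorem trace_transpose_mul_mul_le {G : Matrix ι ι ℝ} {K : ℝ}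
    (hG : ∀ x : ι → ℝ, x ⬝ᵥ G *ᵥ x ≤ K * (x ⬝ᵥ x)) (N : Matrix ι κ ℝ) :
    (Nᵀ * G * N).trace ≤ K * (Nᵀ * N).trace := by
  rw [trace_transpose_mul_mul, trace_transpose_mul_self, Finset.mul_sum]
  exact Finset.sum_le_sum fun k _ => hG _

theorem le_trace_transpose_mul_mul {G : Matrix ι ι ℝ} {K : ℝ}
    (hG : ∀ x : ι → ℝ, K * (x ⬝ᵥ x) ≤ x ⬝ᵥ G *ᵥ x) (N : Matrix ι κ ℝ) :
    K * (Nᵀ * N).trace ≤ (Nᵀ * G * N).trace := by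
  rw [trace_transpose_mul_mul, trace_transpose_mul_self, Finset.mul_sum]
  exact Finset.sum_le_sum fun k _ => hG _

theorem exists_eq_transpose_mul_self [DecidableEq ι] {G : Matrix ι ι ℝ} (hG : G.PosSemidef) :
    ∃ B : Matrix ι ι ℝ, G = Bᵀ * B := by
  obtain ⟨B, hB⟩ := CStarAlgebra.nonneg_iff_eq_star_mul_self.1 hG.nonneg
  exact ⟨B, by rw [hB, star_eq_conjTranspose, conjTranspose_eq_transpose_of_trivial]⟩

/-- With `G = BᵀB` and `N = ABᵀ`, the trace of `AGAG` becomes that of `NᵀGN`, to which a bound on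
the form of `G` applies. `trace_factor_comm` then rewrites `NᵀN` so that the same bound applies a
second time. -/
theorem trace_symm_factor (B A : Matrix ι ι ℝ) (hA : Aᵀ = A) :
    (A * (Bᵀ * B) * A * (Bᵀ * B)).trace = ((A * Bᵀ)ᵀ * (Bᵀ * B) * (A * Bᵀ)).trace := by
  rw [transpose_mul, transpose_transpose, hA, ← Matrix.mul_assoc _ Bᵀ B, trace_mul_comm]
  simp only [Matrix.mul_assoc]

theorem trace_factor_comm (B A : Matrix ι ι ℝ) (hA : Aᵀ = A) :
    ((A * Bᵀ)ᵀ * (A * Bᵀ)).trace = (Aᵀ * (Bᵀ * B) * A).trace := by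
  rw [trace_mul_comm, transpose_mul, transpose_transpose, hA]
  simp only [Matrix.mul_assoc]

theorem trace_mul_mul_mul_le [DecidableEq ι] {G A : Matrix ι ι ℝ} {K : ℝ} (hA : Aᵀ = A)
    (hG : G.PosSemidef) (hK : 0 ≤ K) (hGK : ∀ x : ι → ℝ, x ⬝ᵥ G *ᵥ x ≤ K * (x ⬝ᵥ x)) :
    (A * G * A * G).trace ≤ K ^ 2 * (A * A).trace := by
  obtain ⟨B, rfl⟩ := exists_eq_transpose_mul_self hG
  rw [trace_symm_factor B A hA]
  refine (trace_transpose_mul_mul_le hGK _).trans ?_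
  rw [trace_factor_comm B A hA, pow_two, mul_assoc K]
  refine mul_le_mul_of_nonneg_left ?_ hK
  simpa only [hA] using trace_transpose_mul_mul_le hGK A

theorem le_trace_mul_mul_mul [DecidableEq ι] {G A : Matrix ι ι ℝ} {K : ℝ} (hA : Aᵀ = A)
    (hG : G.PosSemidef) (hK : 0 ≤ K) (hGK : ∀ x : ι → ℝ, K * (x ⬝ᵥ x) ≤ x ⬝ᵥ G *ᵥ x) :
    K ^ 2 * (A * A).trace ≤ (A * G * A * G).trace := by
  obtain ⟨B, rfl⟩ := exists_eq_transpose_mul_self hG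
  rw [trace_symm_factor B A hA]
  refine le_trans ?_ (le_trace_transpose_mul_mul hGK _)
  rw [trace_factor_comm B A hA, pow_two, mul_assoc K]
  refine mul_le_mul_of_nonneg_left ?_ hK
  simpa only [hA] using le_trace_transpose_mul_mul hGK A

/-- A matrix and its transpose have the same operator norm: with `w = Zᵀy`, expand `‖Zw - Ky‖² ≥ 0`.
-/
theorem transpose_mulVec_dotProduct_le {Z : Matrix ι κ ℝ} {K : ℝ} (hK : 0 ≤ K)
    (hZ : ∀ x : κ → ℝ, (Z *ᵥ x) ⬝ᵥ (Z *ᵥ x) ≤ K * (x ⬝ᵥ x)) (y : ι → ℝ) :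
    (Zᵀ *ᵥ y) ⬝ᵥ (Zᵀ *ᵥ y) ≤ K * (y ⬝ᵥ y) := by
  set w := Zᵀ *ᵥ y with hw
  have h1 : (Z *ᵥ w) ⬝ᵥ y = w ⬝ᵥ w := by
    conv_rhs => rw [hw, dotProduct_mulVec, vecMul_transpose, ← hw]
  have h2 := hZ w
  have h3 : ∀ c : ℝ, 0 ≤ (Z *ᵥ w) ⬝ᵥ (Z *ᵥ w) - 2 * c * (w ⬝ᵥ w) + c ^ 2 * (y ⬝ᵥ y) := by
    intro c
    have h : 0 ≤ (Z *ᵥ w - c • y) ⬝ᵥ (Z *ᵥ w - c • y) :=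
      Finset.sum_nonneg fun i _ => mul_self_nonneg _
    simp only [sub_dotProduct, dotProduct_sub, smul_dotProduct, dotProduct_smul, smul_eq_mul, h1,
      dotProduct_comm y] at h
    linarith
  rcases hK.eq_or_lt with rfl | hK
  · have h4 : Z *ᵥ w = 0 := by
      refine dotProduct_self_eq_zero.1 (le_antisymm (by linarith) ?_)
      exact Finset.sum_nonneg fun i _ => mul_self_nonneg _
    rw [h4, zero_dotProduct] at h1
    rw [← h1, zero_mul]
  · have h5 := h3 K
    have h6 : K * (w ⬝ᵥ w) ≤ K * (K * (y ⬝ᵥ y)) := by nlinarith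
    exact le_of_mul_le_mul_left h6 hK

/-- A symmetric matrix whose quadratic form is bounded by `L` in absolute value satisfies
`‖H x‖ ≤ L ‖x‖`. -/
theorem dotProduct_mul_self_mulVec_le {H : Matrix ι ι ℝ} {L : ℝ} (hH : Hᵀ = H) (hL : 0 ≤ L)
    (hHL : ∀ x : ι → ℝ, |x ⬝ᵥ H *ᵥ x| ≤ L * (x ⬝ᵥ x)) (x : ι → ℝ) :
    x ⬝ᵥ (H * H) *ᵥ x ≤ L ^ 2 * (x ⬝ᵥ x) := by
  have hsymm : ∀ u v : ι → ℝ, u ⬝ᵥ H *ᵥ v = v ⬝ᵥ H *ᵥ u := by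
    intro u v
    rw [dotProduct_mulVec, ← mulVec_transpose, hH, dotProduct_comm]
  have hxx : x ⬝ᵥ (H * H) *ᵥ x = (H *ᵥ x) ⬝ᵥ (H *ᵥ x) := by
    rw [← mulVec_mulVec, hsymm]
  -- Polarization: the forms at `x + cHx` and `x - cHx` differ by `4c‖Hx‖²`, and the parallelogram
  -- law bounds the difference. The best choice is `c = 1/L`.
  have key : ∀ c : ℝ, 4 * c * ((H *ᵥ x) ⬝ᵥ (H *ᵥ x))
      ≤ 2 * L * (x ⬝ᵥ x + c ^ 2 * ((H *ᵥ x) ⬝ᵥ (H *ᵥ x))) := by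
    intro c
    have h1 := (abs_le.1 (hHL (x + c • (H *ᵥ x)))).2
    have h2 := (abs_le.1 (hHL (x - c • (H *ᵥ x)))).1
    simp only [mulVec_add, mulVec_sub, mulVec_smul, dotProduct_add, add_dotProduct, sub_dotProduct,
      dotProduct_sub, smul_dotProduct, dotProduct_smul, smul_eq_mul] at h1 h2
    have h3 : x ⬝ᵥ H *ᵥ (H *ᵥ x) = (H *ᵥ x) ⬝ᵥ (H *ᵥ x) := hsymm _ _
    rw [h3] at h1 h2
    have h4 := dotProduct_comm x (H *ᵥ x)
    linarith
  rw [hxx]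
  have hn : 0 ≤ (H *ᵥ x) ⬝ᵥ (H *ᵥ x) := Finset.sum_nonneg fun i _ => mul_self_nonneg _
  rcases hL.eq_or_lt with rfl | hL
  · have := key 1
    nlinarith
  · have h5 := key L⁻¹
    have h6 : L * (4 * L⁻¹ * ((H *ᵥ x) ⬝ᵥ (H *ᵥ x))) = 4 * ((H *ᵥ x) ⬝ᵥ (H *ᵥ x)) := by
      field_simp
    have h7 : L * (2 * L * (x ⬝ᵥ x + L⁻¹ ^ 2 * ((H *ᵥ x) ⬝ᵥ (H *ᵥ x))))
        = 2 * L ^ 2 * (x ⬝ᵥ x) + 2 * ((H *ᵥ x) ⬝ᵥ (H *ᵥ x)) := by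
      field_simp
    have h8 := mul_le_mul_of_nonneg_left h5 hL.le
    rw [h6, h7] at h8
    linarith

/-- Compressing a symmetric matrix to a subspace loses little of its Frobenius norm when the
codimension is small. -/
theorem le_trace_compression_sq [DecidableEq ι] [DecidableEq κ] {H : Matrix ι ι ℝ} {L : ℝ}
    (hH : Hᵀ = H) (hL : 0 ≤ L) (hHL : ∀ x : ι → ℝ, |x ⬝ᵥ H *ᵥ x| ≤ L * (x ⬝ᵥ x))
    {V : Matrix ι κ ℝ} (hV : Vᵀ * V = 1) :
    (H * H).trace - 2 * L ^ 2 * (Fintype.card ι - Fintype.card κ)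
      ≤ (Vᵀ * H * V * (Vᵀ * H * V)).trace := by
  -- `Q` projects onto the orthogonal complement of the range of `V`. Expanding with `VVᵀ = 1 - Q`,
  -- the loss is at most `2 tr(QH²) ≤ 2L² tr Q`, since `tr(QHQH) = ‖QHQ‖²` is nonnegative.
  set Q : Matrix ι ι ℝ := 1 - V * Vᵀ with hQ
  have hQt : Qᵀ = Q := by simp [hQ]
  have hVQ : V * Vᵀ = 1 - Q := by simp [hQ]
  have hQQ : Q * Q = Q := by
    have : V * Vᵀ * (V * Vᵀ) = V * Vᵀ := by
      rw [Matrix.mul_assoc, ← Matrix.mul_assoc Vᵀ, hV, Matrix.one_mul]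
    rw [hQ]
    simp only [Matrix.sub_mul, Matrix.mul_sub, Matrix.one_mul, Matrix.mul_one, this]
    abel
  have htrQ : Q.trace = Fintype.card ι - Fintype.card κ := by
    rw [hQ, trace_sub, trace_mul_comm, hV, trace_one, trace_one]
  have h1 : (Vᵀ * H * V * (Vᵀ * H * V)).trace = ((1 - Q) * H * (1 - Q) * H).trace := by
    rw [← hVQ, Matrix.mul_assoc Vᵀ H V, Matrix.mul_assoc Vᵀ, trace_mul_comm]
    simp only [Matrix.mul_assoc]
    rw [trace_mul_comm]
    simp only [Matrix.mul_assoc]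
  have h2 : ((1 - Q) * H * (1 - Q) * H).trace
      = (H * H).trace - 2 * (Q * (H * H)).trace + (Q * H * Q * H).trace := by
    have e : (H * Q * H).trace = (Q * (H * H)).trace := by
      rw [Matrix.mul_assoc, trace_mul_comm, Matrix.mul_assoc]
    have : (1 - Q) * H * (1 - Q) * H = H * H - H * Q * H - Q * (H * H) + Q * H * Q * H := by
      simp only [Matrix.sub_mul, Matrix.mul_sub, Matrix.one_mul, Matrix.mul_one, Matrix.mul_assoc]
      abel
    rw [this, trace_add, trace_sub, trace_sub, e]
    ring
  have h3 : (Q * (H * H)).trace = (Qᵀ * (H * H) * Q).trace := by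
    rw [hQt, trace_mul_comm (Q * (H * H)), ← Matrix.mul_assoc Q Q, hQQ]
  have h4 : (Qᵀ * (H * H) * Q).trace ≤ L ^ 2 * Q.trace := by
    refine (trace_transpose_mul_mul_le (dotProduct_mul_self_mulVec_le hH hL hHL) Q).trans ?_
    rw [hQt, hQQ]
  have h5 : 0 ≤ (Q * H * Q * H).trace := by
    have h6 := trace_transpose_mul_self_nonneg (Q * H * Q)
    have h7 : (Q * H * Q)ᵀ * (Q * H * Q) = Q * H * (Q * Q) * H * Q := by
      simp only [transpose_mul, hQt, hH, Matrix.mul_assoc]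
    rw [h7, hQQ, trace_mul_comm] at h6
    simp only [← Matrix.mul_assoc, hQQ] at h6
    exact h6
  rw [h1, h2, h3, ← htrQ]
  linarith

end Trace

/-! ### Simultaneous diagonalization of two quadratic forms -/

section Diagonalization

variable {κ : Type*} [Fintype κ] [DecidableEq κ] {S H W : Matrix κ κ ℝ} {l : κ → ℝ}

/-- Simultaneous diagonalization by congruence of a positive definite matrix and a symmetric
matrix. -/
theorem exists_simultaneous_diagonalization (hS : S.PosDef) (hH : Hᵀ = H) :
    ∃ (W : Matrix κ κ ℝ) (l : κ → ℝ), Wᵀ * S * W = 1 ∧ Wᵀ * H * W = diagonal l := by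
  obtain ⟨B, hB⟩ := exists_eq_transpose_mul_self hS.posSemidef
  have hBu : IsUnit B.det := by
    have h := hS.det_pos
    rw [hB, det_mul] at h
    exact isUnit_iff_ne_zero.2 (right_ne_zero_of_mul h.ne')
  have hM : (B⁻¹ᵀ * H * B⁻¹).IsHermitian := by
    rw [IsHermitian, conjTranspose_eq_transpose_of_trivial]
    simp only [transpose_mul, transpose_transpose, hH, Matrix.mul_assoc]
  set U : Matrix κ κ ℝ := (hM.eigenvectorUnitary : Matrix κ κ ℝ) with hU
  have hUU : Uᵀ * U = 1 := by
    have := Unitary.coe_star_mul_self hM.eigenvectorUnitary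
    rwa [star_eq_conjTranspose, conjTranspose_eq_transpose_of_trivial] at this
  have hsp : B⁻¹ᵀ * H * B⁻¹ = U * diagonal hM.eigenvalues * Uᵀ := by
    have := hM.spectral_theorem
    rw [Unitary.conjStarAlgAut_apply] at this
    rw [star_eq_conjTranspose, conjTranspose_eq_transpose_of_trivial] at this
    exact this
  refine ⟨B⁻¹ * U, hM.eigenvalues, ?_, ?_⟩
  · have h1 : B * B⁻¹ = 1 := mul_nonsing_inv _ hBu
    calc (B⁻¹ * U)ᵀ * S * (B⁻¹ * U) = Uᵀ * (B * B⁻¹)ᵀ * (B * B⁻¹) * U := by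
          rw [hB]
          simp only [transpose_mul, Matrix.mul_assoc]
      _ = 1 := by simp [h1, hUU]
  · calc (B⁻¹ * U)ᵀ * H * (B⁻¹ * U) = Uᵀ * (B⁻¹ᵀ * H * B⁻¹) * U := by
          simp only [transpose_mul, Matrix.mul_assoc]
      _ = Uᵀ * (U * diagonal hM.eigenvalues * Uᵀ) * U := congrArg (fun N => Uᵀ * N * U) hsp
      _ = (Uᵀ * U) * diagonal hM.eigenvalues * (Uᵀ * U) := by
          simp only [Matrix.mul_assoc]
      _ = diagonal hM.eigenvalues := by simp [hUU]

theorem inv_eq_mul_transpose_of_congr (hW : Wᵀ * S * W = 1) : S⁻¹ = W * Wᵀ := by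
  have h : W * (Wᵀ * S) = 1 := mul_eq_one_comm.1 hW
  exact inv_eq_left_inv (by rw [Matrix.mul_assoc, h])

/-- A column `w` of `W` has `wᵀSw = 1`, hence `‖w‖² ≤ 1/s`, while `l k = wᵀHw`. -/
theorem abs_diag_le_of_congr (hW : Wᵀ * S * W = 1) (hWH : Wᵀ * H * W = diagonal l) {s L : ℝ}
    (hs : 0 < s) (hL : 0 ≤ L) (hSs : ∀ x : κ → ℝ, s * (x ⬝ᵥ x) ≤ x ⬝ᵥ S *ᵥ x)
    (hHL : ∀ x : κ → ℝ, |x ⬝ᵥ H *ᵥ x| ≤ L * (x ⬝ᵥ x)) (k : κ) : |l k| ≤ L / s := by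
  have entry : ∀ G : Matrix κ κ ℝ, (Wᵀ * G * W) k k = W.col k ⬝ᵥ G *ᵥ W.col k := by
    intro G
    rw [Matrix.mul_assoc]
    rfl
  have h1 := entry S
  have h2 := entry H
  rw [hW, one_apply_eq] at h1
  rw [hWH, diagonal_apply_eq] at h2
  have h3 := hSs (W.col k)
  rw [← h1] at h3
  rw [h2, le_div_iff₀ hs]
  calc |W.col k ⬝ᵥ H *ᵥ W.col k| * s ≤ L * (W.col k ⬝ᵥ W.col k) * s :=
        mul_le_mul_of_nonneg_right (hHL _) hs.le
    _ = L * (s * (W.col k ⬝ᵥ W.col k)) := by ring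
    _ ≤ L * 1 := mul_le_mul_of_nonneg_left h3 hL
    _ = L := mul_one L

/-- Inverting the congruence gives `tr(H²) = tr(DGDG)` with `D = diagonal l` and `G = WᵀS²W`. Since
`WᵀSW = 1`, the form of `G` inherits the bound `K` of `S`. -/
theorem trace_mul_self_le_of_congr (hS : S.PosDef) (hW : Wᵀ * S * W = 1)
    (hWH : Wᵀ * H * W = diagonal l) {K : ℝ} (hK : 0 ≤ K)
    (hSK : ∀ x : κ → ℝ, x ⬝ᵥ S *ᵥ x ≤ K * (x ⬝ᵥ x)) :
    (H * H).trace ≤ K ^ 2 * ∑ k, l k ^ 2 := by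
  have hSt : Sᵀ = S := by
    have := hS.isHermitian
    rwa [IsHermitian, conjTranspose_eq_transpose_of_trivial] at this
  have e1 : S * W * Wᵀ = 1 := by
    rw [Matrix.mul_assoc, ← inv_eq_mul_transpose_of_congr hW]
    exact mul_nonsing_inv _ hS.det_pos.ne'.isUnit
  have e2 : W * Wᵀ * S = 1 := by
    rw [← inv_eq_mul_transpose_of_congr hW]
    exact nonsing_inv_mul _ hS.det_pos.ne'.isUnit
  have hH : H = S * W * diagonal l * Wᵀ * S := by
    calc H = (S * W * Wᵀ) * H * (W * Wᵀ * S) := by rw [e1, e2]; simp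
      _ = S * W * (Wᵀ * H * W) * Wᵀ * S := by simp only [Matrix.mul_assoc]
      _ = S * W * diagonal l * Wᵀ * S := by rw [hWH]
  have hG : (Wᵀ * (S * S) * W).PosSemidef := by
    have h := posSemidef_conjTranspose_mul_self (S * W)
    rw [conjTranspose_eq_transpose_of_trivial, transpose_mul, hSt] at h
    simpa only [Matrix.mul_assoc] using h
  obtain ⟨B, hB⟩ := exists_eq_transpose_mul_self hS.posSemidef
  have hGK : ∀ x : κ → ℝ, x ⬝ᵥ (Wᵀ * (S * S) * W) *ᵥ x ≤ K * (x ⬝ᵥ x) := by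
    intro x
    have hSn : ∀ y : κ → ℝ, y ⬝ᵥ S *ᵥ y = (B *ᵥ y) ⬝ᵥ (B *ᵥ y) := by
      intro y
      rw [hB, ← mulVec_mulVec, dotProduct_mulVec _ Bᵀ, vecMul_transpose]
    have f1 : x ⬝ᵥ (Wᵀ * (S * S) * W) *ᵥ x
        = (Bᵀ *ᵥ B *ᵥ W *ᵥ x) ⬝ᵥ (Bᵀ *ᵥ B *ᵥ W *ᵥ x) := by
      rw [mulVec_mulVec _ Bᵀ B, ← hB]
      simp only [← mulVec_mulVec, dotProduct_mulVec _ Wᵀ, vecMul_transpose]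
      rw [dotProduct_mulVec _ S, ← mulVec_transpose, hSt]
    have f2 : x ⬝ᵥ x = (B *ᵥ W *ᵥ x) ⬝ᵥ (B *ᵥ W *ᵥ x) := by
      rw [← hSn, mulVec_mulVec, ← vecMul_transpose W, ← dotProduct_mulVec, mulVec_mulVec,
        ← Matrix.mul_assoc, hW, one_mulVec]
    rw [f1, f2]
    exact transpose_mulVec_dotProduct_le hK (fun y => (hSn y).symm.trans_le (hSK y)) _
  have htr : (H * H).trace
      = (diagonal l * (Wᵀ * (S * S) * W) * diagonal l * (Wᵀ * (S * S) * W)).trace := by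
    rw [hH]
    simp only [Matrix.mul_assoc]
    rw [trace_mul_comm]
    simp only [Matrix.mul_assoc]
    rw [trace_mul_comm]
    simp only [Matrix.mul_assoc]
  rw [htr]
  refine (trace_mul_mul_mul_le (diagonal_transpose l) hG hK hGK).trans (le_of_eq ?_)
  rw [diagonal_mul_diagonal, trace_diagonal]
  simp only [pow_two]

end Diagonalization

/-! ### Linear images of Gaussian vectors -/

theorem map_mulVec_multivariateGaussian {ι κ : Type*} [Fintype ι] [Fintype κ] [DecidableEq ι]
    [DecidableEq κ] {S : Matrix ι ι ℝ} (hS : S.PosSemidef) (A : Matrix κ ι ℝ) :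
    (multivariateGaussian 0 S).map (fun y => WithLp.toLp 2 (A *ᵥ y.ofLp))
      = multivariateGaussian 0 (A * S * Aᵀ) := by
  have hm : Measurable fun y : EuclideanSpace ℝ ι => WithLp.toLp 2 (A *ᵥ y.ofLp) := by
    have : Continuous fun y : EuclideanSpace ℝ ι => WithLp.toLp 2 (A *ᵥ y.ofLp) := by fun_prop
    exact this.measurable
  have hAS : (A * S * Aᵀ).PosSemidef := by
    have := hS.mul_mul_conjTranspose_same A
    rwa [conjTranspose_eq_transpose_of_trivial] at this
  have := Measure.isProbabilityMeasure_map (μ := multivariateGaussian 0 S) hm.aemeasurable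
  refine Measure.ext_of_charFun (funext fun t => ?_)
  have h1 : charFun ((multivariateGaussian 0 S).map (fun y => WithLp.toLp 2 (A *ᵥ y.ofLp))) t
      = charFun (multivariateGaussian 0 S) (WithLp.toLp 2 (Aᵀ *ᵥ t.ofLp)) := by
    rw [charFun_apply, charFun_apply, integral_map hm.aemeasurable
      (Measurable.aestronglyMeasurable (by fun_prop))]
    congr with y
    congr 3
    rw [EuclideanSpace.inner_eq_star_dotProduct, EuclideanSpace.inner_eq_star_dotProduct]
    simp only [star_trivial]
    rw [dotProduct_mulVec, ← mulVec_transpose]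
  rw [h1, charFun_multivariateGaussian hS, charFun_multivariateGaussian hAS]
  congr 2
  · simp
  · simp only [← mulVec_mulVec]
    rw [dotProduct_mulVec t.ofLp A, ← mulVec_transpose]

/-! ### Squares of Gaussian variables -/

/-- The variance of the square of a standard normal variable. -/
noncomputable def gaussianSqVar : ℝ := Var[fun x => x ^ 2; gaussianReal 0 1]

/-- The standardized square of a standard normal variable. -/
noncomputable def stdSq (x : ℝ) : ℝ := (√gaussianSqVar)⁻¹ * (x ^ 2 - 1)

theorem memLp_sq_gaussianReal : MemLp (fun x : ℝ => x ^ 2) 2 (gaussianReal 0 1) := by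
  rw [memLp_two_iff_integrable_sq (by fun_prop)]
  have h := (memLp_id_gaussianReal (μ := 0) (v := 1) 4).integrable_norm_pow (by norm_num)
  refine h.congr (Eventually.of_forall fun x => ?_)
  have : ‖id x‖ ^ 4 = (x ^ 2) ^ 2 := by
    rw [id, Real.norm_eq_abs, show 4 = 2 * 2 by norm_num, pow_mul, sq_abs]
  exact_mod_cast this

theorem integral_sq_gaussianReal : ∫ x, x ^ 2 ∂(gaussianReal 0 1) = 1 := by
  have h := variance_of_integral_eq_zero (μ := gaussianReal 0 1) (X := id) (by fun_prop) (by simp)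
  have h2 := variance_id_gaussianReal (μ := 0) (v := 1)
  rw [h] at h2
  simpa using h2

/-- Only positivity of this variance is ever needed, since its value cancels. Zero variance would
force `x² = 1` almost surely, but `{1, -1}` is null. -/
theorem gaussianSqVar_pos : 0 < gaussianSqVar := by
  refine lt_of_le_of_ne (variance_nonneg _ _) fun h => ?_
  have h1 := ae_eq_integral_of_variance_eq_zero memLp_sq_gaussianReal h.symm
  rw [integral_sq_gaussianReal] at h1
  have := nullSingletonClass_gaussianReal (μ := 0) (v := 1) one_ne_zero
  have h2 : ∀ᵐ x ∂(gaussianReal 0 1), x ∉ ({1, -1} : Set ℝ) :=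
    measure_eq_zero_iff_ae_notMem.1 (Set.Finite.measure_zero (by simp) _)
  obtain ⟨x, hx1, hx2⟩ := (h1.and h2).exists
  exact hx2 (by simpa using hx1)

theorem integral_stdSq : (gaussianReal 0 1)[stdSq] = 0 := by
  simp only [stdSq]
  rw [integral_const_mul, integral_sub (memLp_sq_gaussianReal.integrable (by norm_num))
    (integrable_const _), integral_sq_gaussianReal]
  simp

theorem integral_stdSq_sq : (gaussianReal 0 1)[stdSq ^ 2] = 1 := by
  have h : (gaussianReal 0 1)[stdSq ^ 2]
      = gaussianSqVar⁻¹ * ∫ x, (x ^ 2 - 1) ^ 2 ∂(gaussianReal 0 1) := by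
    rw [← integral_const_mul]
    congr with x
    simp only [Pi.pow_apply, stdSq, mul_pow, inv_pow, Real.sq_sqrt gaussianSqVar_pos.le]
  have h2 : gaussianSqVar = ∫ x, (x ^ 2 - 1) ^ 2 ∂(gaussianReal 0 1) := by
    rw [gaussianSqVar, variance_eq_integral (by fun_prop), integral_sq_gaussianReal]
  rw [h, ← h2, inv_mul_cancel₀ gaussianSqVar_pos.ne']

theorem measurable_stdSq : Measurable stdSq := by
  unfold stdSq
  fun_prop

theorem measurable_sum_mul_stdSq {κ : Type*} [Fintype κ] (c : κ → ℝ) :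
    Measurable fun x : κ → ℝ => ∑ k, c k * stdSq (x k) :=
  Finset.measurable_sum _ fun k _ => (measurable_stdSq.comp (measurable_pi_apply k)).const_mul _

/-! ### The score in direction `v` of a linear covariance model -/

section Score

variable {q : ℕ} {κ : Type*} [Fintype κ] [DecidableEq κ]
variable (S : Param q →ₗ[ℝ] Matrix κ κ ℝ)

/-- The derivative of the log-likelihood at `ψ` in the direction `v`. -/
noncomputable def dirScore (ψ v : Param q) (y : κ → ℝ) : ℝ :=
  -(1 / 2) * (((S ψ)⁻¹ * S v).trace - y ⬝ᵥ ((S ψ)⁻¹ * S v * (S ψ)⁻¹) *ᵥ y)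

theorem dirScore_eq_sum (ψ v : Param q) (y : κ → ℝ) :
    dirScore S ψ v y = ∑ j, v j * dirScore S ψ (EuclideanSpace.single j 1) y := by
  have hv : v = ∑ j, v j • EuclideanSpace.single j (1 : ℝ) := by
    ext i
    simp [Pi.single_apply, -Fintype.sum_option]
  have hS : S v = ∑ j, v j • S (EuclideanSpace.single j 1) := by
    conv_lhs => rw [hv]
    rw [map_sum]
    simp only [map_smul]
  simp only [dirScore]
  rw [hS]
  simp only [Finset.mul_sum, Finset.sum_mul, trace_sum, Matrix.mul_smul, Matrix.smul_mul,
    trace_smul, smul_eq_mul]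
  rw [Matrix.sum_mulVec, dotProduct_sum, ← Finset.sum_sub_distrib, Finset.mul_sum]
  refine Finset.sum_congr rfl fun j _ => ?_
  rw [smul_mulVec, dotProduct_smul, smul_eq_mul]
  ring

variable {S} {ψ v : Param q} {W : Matrix κ κ ℝ} {l : κ → ℝ}

theorem dirScore_eq_of_congr (hW : Wᵀ * S ψ * W = 1) (hWH : Wᵀ * S v * W = diagonal l)
    (y : κ → ℝ) : dirScore S ψ v y = ∑ k, l k / 2 * ((Wᵀ *ᵥ y) k ^ 2 - 1) := by
  have h1 : ((S ψ)⁻¹ * S v).trace = ∑ k, l k := by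
    rw [inv_eq_mul_transpose_of_congr hW, Matrix.mul_assoc, trace_mul_comm, hWH, trace_diagonal]
  have h2 : y ⬝ᵥ ((S ψ)⁻¹ * S v * (S ψ)⁻¹) *ᵥ y = ∑ k, l k * (Wᵀ *ᵥ y) k ^ 2 := by
    have e : (S ψ)⁻¹ * S v * (S ψ)⁻¹ = W * (diagonal l * Wᵀ) := by
      rw [inv_eq_mul_transpose_of_congr hW, ← hWH]
      simp only [Matrix.mul_assoc]
    rw [e, ← mulVec_mulVec, ← mulVec_mulVec, dotProduct_mulVec, ← mulVec_transpose]
    simp only [dotProduct, mulVec_diagonal]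
    exact Finset.sum_congr rfl fun k _ => by ring
  rw [dirScore, h1, h2, ← Finset.sum_sub_distrib, Finset.mul_sum]
  exact Finset.sum_congr rfl fun k _ => by ring

/-- One congruence diagonalizes the whole line: `WᵀS(ψ + tv)W` has diagonal entries `1 + t l k`.
Near `t = 0` the log-likelihood is therefore an explicit scalar function, even when `ψ` lies on the
boundary of the parameter set. -/
theorem lineDeriv_logLik (hψ : (S ψ).PosDef) (hv : (S v)ᵀ = S v) (y : κ → ℝ) :
    lineDeriv ℝ (fun φ : Param q => logLik S φ y) ψ v = dirScore S ψ v y := by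
  obtain ⟨W, l, hW, hWH⟩ := exists_simultaneous_diagonalization hψ hv
  rw [dirScore_eq_of_congr hW hWH, lineDeriv]
  have hdetW : W.det ^ 2 * (S ψ).det = 1 := by
    have := congrArg det hW
    rw [det_mul, det_mul, det_transpose, det_one] at this
    linarith
  have hdet0 := hψ.det_pos
  have hline : ∀ t : ℝ, Wᵀ * S (ψ + t • v) * W = diagonal (fun k => 1 + t * l k) := by
    intro t
    rw [map_add, map_smul, Matrix.mul_add, Matrix.add_mul, hW, Matrix.mul_smul, Matrix.smul_mul,
      hWH, ← diagonal_one, ← diagonal_smul, diagonal_add]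
    rfl
  have hev : ∀ᶠ t in 𝓝 (0 : ℝ), ∀ k, 0 < 1 + t * l k := by
    rw [eventually_all]
    intro k
    have hc : Continuous fun t : ℝ => 1 + t * l k := by fun_prop
    exact (hc.tendsto 0).eventually (lt_mem_nhds (by simp))
  have heq : (fun t : ℝ => logLik S (ψ + t • v) y) =ᶠ[𝓝 0] fun t =>
      -(1 / 2) * (Real.log (S ψ).det + ∑ k, Real.log (1 + t * l k)
        + ∑ k, (Wᵀ *ᵥ y) k ^ 2 * (1 + t * l k)⁻¹) := by
    filter_upwards [hev] with t ht
    have hne : ∀ k, 1 + t * l k ≠ 0 := fun k => (ht k).ne'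
    have hdet : (S (ψ + t • v)).det = (S ψ).det * ∏ k, (1 + t * l k) := by
      have h := congrArg det (hline t)
      rw [det_mul, det_mul, det_transpose, det_diagonal] at h
      rw [← h]
      calc (S (ψ + t • v)).det = (W.det ^ 2 * (S ψ).det) * (S (ψ + t • v)).det := by
            rw [hdetW, one_mul]
        _ = _ := by ring
    have hinv : (S (ψ + t • v))⁻¹ = W * (diagonal (fun k => (1 + t * l k)⁻¹) * Wᵀ) := by
      have h1 : W * (diagonal (fun k => (1 + t * l k)⁻¹) * (Wᵀ * S (ψ + t • v))) = 1 := by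
        rw [mul_eq_one_comm, Matrix.mul_assoc, hline, diagonal_mul_diagonal, ← diagonal_one]
        congr 1
        funext k
        exact inv_mul_cancel₀ (hne k)
      refine inv_eq_left_inv ?_
      simpa only [Matrix.mul_assoc] using h1
    rw [logLik, hdet, hinv, Real.log_mul hdet0.ne' (Finset.prod_ne_zero_iff.2 fun k _ => hne k),
      Real.log_prod (fun k _ => hne k), ← mulVec_mulVec, ← mulVec_mulVec, dotProduct_mulVec,
      ← mulVec_transpose]
    congr 2
    simp only [dotProduct, mulVec_diagonal]
    exact Finset.sum_congr rfl fun k _ => by ring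
  rw [heq.deriv_eq]
  have hlin : ∀ k, HasDerivAt (fun t : ℝ => 1 + t * l k) (l k) 0 := fun k => by
    simpa using ((hasDerivAt_id (0 : ℝ)).mul_const (l k)).const_add 1
  have hlog : HasDerivAt (fun t : ℝ => ∑ k, Real.log (1 + t * l k)) (∑ k, l k) 0 := by
    refine HasDerivAt.fun_sum fun k _ => ?_
    simpa using (hlin k).log (by simp)
  have hq : HasDerivAt (fun t : ℝ => ∑ k, (Wᵀ *ᵥ y) k ^ 2 * (1 + t * l k)⁻¹)
      (∑ k, (Wᵀ *ᵥ y) k ^ 2 * (-l k)) 0 := by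
    refine HasDerivAt.fun_sum fun k _ => HasDerivAt.const_mul _ ?_
    simpa using (hlin k).fun_inv (by simp)
  have := (((hlog.const_add (Real.log (S ψ).det)).add hq).const_mul (-(1 / 2))).deriv
  refine this.trans ?_
  rw [← Finset.sum_add_distrib, Finset.mul_sum]
  exact Finset.sum_congr rfl fun k _ => by ring

theorem score_eq_dirScore (hψ : (S ψ).PosDef) (hS : ∀ v, (S v)ᵀ = S v) (y : κ → ℝ)
    (j : ParamIndex q) : score S ψ y j = dirScore S ψ (EuclideanSpace.single j 1) y :=
  lineDeriv_logLik hψ (hS _) y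

theorem continuous_dirScore (S : Param q →ₗ[ℝ] Matrix κ κ ℝ) (ψ v : Param q) :
    Continuous (dirScore S ψ v) := by
  unfold dirScore
  fun_prop

/-- The law of the directional score is that of a weighted sum of independent centred chi-squared
variables. -/
theorem map_dirScore (hψ : (S ψ).PosDef) (hW : Wᵀ * S ψ * W = 1)
    (hWH : Wᵀ * S v * W = diagonal l) :
    (multivariateGaussian 0 (S ψ)).map (fun y => dirScore S ψ v y.ofLp)
      = (Measure.pi fun _ : κ => gaussianReal 0 1).map
          (fun x => ∑ k, √gaussianSqVar * (l k / 2) * stdSq (x k)) := by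
  have hcont : Continuous fun y : EuclideanSpace ℝ κ => ∑ k, l k / 2 * (y.ofLp k ^ 2 - 1) := by
    fun_prop
  have hc2 : Continuous fun y : EuclideanSpace ℝ κ => WithLp.toLp 2 (Wᵀ *ᵥ y.ofLp) := by fun_prop
  have h1 : (multivariateGaussian 0 (S ψ)).map (fun y => dirScore S ψ v y.ofLp)
      = ((multivariateGaussian 0 (S ψ)).map (fun y => WithLp.toLp 2 (Wᵀ *ᵥ y.ofLp))).map
        (fun y => ∑ k, l k / 2 * (y.ofLp k ^ 2 - 1)) := by
    rw [Measure.map_map hcont.measurable hc2.measurable]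
    congr 1
    funext y
    exact dirScore_eq_of_congr hW hWH _
  rw [h1, map_mulVec_multivariateGaussian hψ.posSemidef, transpose_transpose, hW,
    multivariateGaussian_zero_one, ← map_pi_eq_stdGaussian,
    Measure.map_map hcont.measurable (by fun_prop)]
  congr 1
  funext x
  refine Finset.sum_congr rfl fun k _ => ?_
  have := Real.sqrt_ne_zero'.2 gaussianSqVar_pos
  simp only [stdSq]
  field_simp

theorem memLp_stdSq : MemLp stdSq 2 (gaussianReal 0 1) := by
  have h := (memLp_sq_gaussianReal.sub (memLp_const (1 : ℝ))).const_mul (√gaussianSqVar)⁻¹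
  exact h

theorem variance_stdSq : Var[stdSq; gaussianReal 0 1] = 1 := by
  rw [variance_of_integral_eq_zero measurable_stdSq.aemeasurable integral_stdSq]
  exact integral_stdSq_sq

theorem variance_dirScore (hψ : (S ψ).PosDef) (hW : Wᵀ * S ψ * W = 1)
    (hWH : Wᵀ * S v * W = diagonal l) :
    Var[fun y => dirScore S ψ v y.ofLp; multivariateGaussian 0 (S ψ)]
      = ∑ k, (√gaussianSqVar * (l k / 2)) ^ 2 := by
  have hm : AEMeasurable (fun y : EuclideanSpace ℝ κ => dirScore S ψ v y.ofLp)
      (multivariateGaussian 0 (S ψ)) :=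
    ((continuous_dirScore S ψ v).comp (by fun_prop)).measurable.aemeasurable
  rw [← variance_id_map hm, map_dirScore hψ hW hWH,
    variance_id_map (measurable_sum_mul_stdSq _).aemeasurable]
  have := variance_sum_pi (μ := fun _ : κ => gaussianReal 0 1)
    (X := fun k x => √gaussianSqVar * (l k / 2) * stdSq x)
    (fun k => memLp_stdSq.const_mul _)
  simp only [variance_const_mul, variance_stdSq, mul_one] at this
  rw [← this]
  congr 1
  funext x
  simp

theorem memLp_dirScore (hψ : (S ψ).PosDef) (hv : (S v)ᵀ = S v) :
    MemLp (fun y : EuclideanSpace ℝ κ => dirScore S ψ v y.ofLp) 2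
      (multivariateGaussian 0 (S ψ)) := by
  obtain ⟨W, l, hW, hWH⟩ := exists_simultaneous_diagonalization hψ hv
  have hm : AEMeasurable (fun y : EuclideanSpace ℝ κ => dirScore S ψ v y.ofLp)
      (multivariateGaussian 0 (S ψ)) :=
    ((continuous_dirScore S ψ v).comp (by fun_prop)).measurable.aemeasurable
  have h1 : MemLp id 2 ((multivariateGaussian 0 (S ψ)).map (fun y => dirScore S ψ v y.ofLp)) := by
    rw [map_dirScore hψ hW hWH,
      memLp_map_measure_iff (by fun_prop) (measurable_sum_mul_stdSq _).aemeasurable]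
    refine memLp_finsetSum _ fun k _ => ?_
    have h := (memLp_stdSq.const_mul (√gaussianSqVar * (l k / 2))).comp_measurePreserving
      (measurePreserving_eval (fun _ : κ => gaussianReal 0 1) k)
    exact h
  exact (memLp_map_measure_iff (by fun_prop) hm).1 h1

theorem charFun_map_dirScore (hψ : (S ψ).PosDef) (hW : Wᵀ * S ψ * W = 1)
    (hWH : Wᵀ * S v * W = diagonal l) :
    charFun ((multivariateGaussian 0 (S ψ)).map (fun y => dirScore S ψ v y.ofLp)) 1
      = ∏ k, charFun ((gaussianReal 0 1).map stdSq) (√gaussianSqVar * (l k / 2)) := by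
  rw [map_dirScore hψ hW hWH, charFun_apply_real,
    integral_map (measurable_sum_mul_stdSq _).aemeasurable (by fun_prop)]
  have h : ∀ k, charFun ((gaussianReal 0 1).map stdSq) (√gaussianSqVar * (l k / 2))
      = ∫ x, Complex.exp (((√gaussianSqVar * (l k / 2) * stdSq x : ℝ) : ℂ) * Complex.I)
        ∂(gaussianReal 0 1) := by
    intro k
    rw [charFun_apply_real, integral_map measurable_stdSq.aemeasurable (by fun_prop)]
    congr with x
    push_cast
    rfl
  simp_rw [h]
  rw [← integral_fintype_prod_eq_prod (f := fun k x =>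
    Complex.exp (((√gaussianSqVar * (l k / 2) * stdSq x : ℝ) : ℂ) * Complex.I))]
  congr with x
  rw [← Complex.exp_sum, ← Finset.sum_mul]
  push_cast
  simp

/-- The score is linear in the direction, so bilinearity of covariance applies. Lower bounds on the
information thus become lower bounds on variances. -/
theorem dotProduct_fisherInfo_mulVec (hψ : (S ψ).PosDef) (hS : ∀ v, (S v)ᵀ = S v)
    (v : Param q) : v.ofLp ⬝ᵥ fisherInfo S ψ *ᵥ v.ofLp
      = Var[fun y => dirScore S ψ v y.ofLp; multivariateGaussian 0 (S ψ)] := by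
  have hm : ∀ j : ParamIndex q, MemLp (fun y : EuclideanSpace ℝ κ =>
      v j * dirScore S ψ (EuclideanSpace.single j 1) y.ofLp) 2 (multivariateGaussian 0 (S ψ)) :=
    fun j => (memLp_dirScore hψ (hS _)).const_mul _
  have hm' : AEMeasurable (fun y : EuclideanSpace ℝ κ => dirScore S ψ v y.ofLp)
      (multivariateGaussian 0 (S ψ)) :=
    (memLp_dirScore hψ (hS _)).aestronglyMeasurable.aemeasurable
  rw [← covariance_self hm']
  simp_rw [dirScore_eq_sum S ψ v]
  rw [covariance_fun_sum_fun_sum hm hm]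
  simp only [dotProduct, mulVec, Finset.mul_sum, covariance_const_mul_left,
    covariance_const_mul_right, fisherInfo, of_apply, score_eq_dirScore hψ hS]
  exact Finset.sum_congr rfl fun i _ => Finset.sum_congr rfl fun j _ => by ring

theorem fisherInfo_isHermitian (S : Param q → Matrix κ κ ℝ) (ψ : Param q) :
    (fisherInfo S ψ).IsHermitian := by
  ext i j
  simp only [conjTranspose_apply, fisherInfo, of_apply, star_trivial]
  exact covariance_comm _ _

theorem measurable_stdScore (hψ : (S ψ).PosDef) (hS : ∀ v, (S v)ᵀ = S v) :
    Measurable fun y : κ → ℝ => stdScore S ψ y := by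
  have h : Continuous fun y : κ → ℝ => score S ψ y := by
    refine continuous_pi fun j => ?_
    simp_rw [score_eq_dirScore hψ hS]
    exact continuous_dirScore S ψ _
  have : Continuous fun y : κ → ℝ => stdScore S ψ y := by
    unfold stdScore
    fun_prop
  exact this.measurable

/-- Take `v = I(ψ)^{-1/2} t` and move the symmetric root across the inner product with the score. -/
theorem charFun_map_stdScore (hψ : (S ψ).PosDef) (hS : ∀ v, (S v)ᵀ = S v)
    (hI : (fisherInfo S ψ).PosDef) (t : Param q) :
    ∃ v : Param q, v.ofLp ⬝ᵥ fisherInfo S ψ *ᵥ v.ofLp = ‖t‖ ^ 2 ∧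
      charFun ((multivariateGaussian 0 (S ψ)).map (fun y => stdScore S ψ y.ofLp)) t
        = charFun ((multivariateGaussian 0 (S ψ)).map (fun y => dirScore S ψ v y.ofLp)) 1 := by
  set J := CFC.sqrt (fisherInfo S ψ) with hJ
  have hJJ : J * J = fisherInfo S ψ := CFC.sqrt_mul_sqrt_self _ hI.posSemidef.nonneg
  have hJt : Jᵀ = J := by
    have := (CFC.sqrt_nonneg (fisherInfo S ψ)).isSelfAdjoint.star_eq
    rwa [star_eq_conjTranspose, conjTranspose_eq_transpose_of_trivial] at this
  have hJu : IsUnit J.det := by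
    have h := hI.det_pos
    rw [← hJJ, det_mul] at h
    exact isUnit_iff_ne_zero.2 (right_ne_zero_of_mul h.ne')
  refine ⟨WithLp.toLp 2 (J⁻¹ *ᵥ t.ofLp), ?_, ?_⟩
  · rw [← hJJ, mulVec_mulVec, Matrix.mul_assoc, mul_nonsing_inv _ hJu, Matrix.mul_one,
      dotProduct_mulVec, ← mulVec_transpose, hJt, mulVec_mulVec, mul_nonsing_inv _ hJu,
      one_mulVec, EuclideanSpace.real_norm_sq_eq]
    simp [dotProduct, pow_two]
  · have hst := (measurable_stdScore hψ hS).comp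
      (show Measurable fun y : EuclideanSpace ℝ κ => y.ofLp by fun_prop)
    have hc := ((continuous_dirScore S ψ (WithLp.toLp 2 (J⁻¹ *ᵥ t.ofLp))).comp
      (show Continuous fun y : EuclideanSpace ℝ κ => y.ofLp by fun_prop)).measurable
    simp only [Function.comp_def] at hst hc
    rw [charFun_apply, charFun_apply_real, integral_map hst.aemeasurable (by fun_prop),
      integral_map hc.aemeasurable (by fun_prop)]
    congr with y
    rw [Complex.ofReal_one, one_mul, dirScore_eq_sum]
    congr 3
    rw [EuclideanSpace.inner_eq_star_dotProduct, star_trivial, stdScore]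
    simp only
    rw [← hJ, dotProduct_mulVec, ← mulVec_transpose, transpose_nonsing_inv, hJt]
    simp only [dotProduct, score_eq_dirScore hψ hS]

end Score

/-- A quantitative central limit theorem for the standardized score of a linear covariance
model. -/
theorem norm_charFun_stdScore_sub_le {ε : ℝ} (hε : 0 < ε) :
    ∃ δ > 0, ∀ (q N : ℕ) (S : Param q →ₗ[ℝ] Matrix (Fin N) (Fin N) ℝ) (ψ : Param q)
      (s K L F : ℝ), (∀ v, (S v)ᵀ = S v) → 0 < s → 0 < K → 0 ≤ L → 0 < F →
      (∀ x, s * (x ⬝ᵥ x) ≤ x ⬝ᵥ S ψ *ᵥ x) → (∀ x, x ⬝ᵥ S ψ *ᵥ x ≤ K * (x ⬝ᵥ x)) →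
      (∀ v x, |x ⬝ᵥ S v *ᵥ x| ≤ L * ‖v‖ * (x ⬝ᵥ x)) →
      (∀ v, F * ‖v‖ ^ 2 ≤ (S v * S v).trace) →
      ∀ t : Param q, (L * K * ‖t‖) ^ 2 ≤ (δ * s) ^ 2 * F →
        ‖charFun ((multivariateGaussian 0 (S ψ)).map (fun y => stdScore S ψ y.ofLp)) t
          - Complex.exp (-‖t‖ ^ 2 / 2)‖ ≤ ε * ‖t‖ ^ 2 := by
  obtain ⟨δ, hδ, h⟩ := norm_prod_charFun_sub_exp_le (P := gaussianReal 0 1)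
    measurable_stdSq.aemeasurable integral_stdSq integral_stdSq_sq hε
  refine ⟨δ, hδ, fun q N S ψ s K L F hS hs hK hL hF hSs hSK hSL hSF t ht => ?_⟩
  have hψ : (S ψ).PosDef := by
    refine PosDef.of_dotProduct_mulVec_pos ?_ fun {x} hx => ?_
    · rw [IsHermitian, conjTranspose_eq_transpose_of_trivial, hS]
    · rw [star_trivial]
      refine lt_of_lt_of_le (mul_pos hs ?_) (hSs x)
      exact lt_of_le_of_ne (Finset.sum_nonneg fun i _ => mul_self_nonneg _)
        fun h0 => hx (dotProduct_self_eq_zero.1 h0.symm)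
  have key : ∀ v : Param q, ∃ W l, Wᵀ * S ψ * W = 1 ∧ Wᵀ * S v * W = diagonal l ∧
      v.ofLp ⬝ᵥ fisherInfo S ψ *ᵥ v.ofLp = ∑ k, (√gaussianSqVar * (l k / 2)) ^ 2 ∧
      F * ‖v‖ ^ 2 * (gaussianSqVar / 4)
        ≤ K ^ 2 * ∑ k, (√gaussianSqVar * (l k / 2)) ^ 2 := by
    intro v
    obtain ⟨W, l, hW, hWH⟩ := exists_simultaneous_diagonalization hψ (hS v)
    refine ⟨W, l, hW, hWH, ?_, ?_⟩
    · rw [dotProduct_fisherInfo_mulVec hψ hS, variance_dirScore hψ hW hWH]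
    · have h1 := (hSF v).trans (trace_mul_self_le_of_congr hψ hW hWH hK.le hSK)
      have h2 : ∑ k, (√gaussianSqVar * (l k / 2)) ^ 2 = gaussianSqVar / 4 * ∑ k, l k ^ 2 := by
        rw [Finset.mul_sum]
        refine Finset.sum_congr rfl fun k _ => ?_
        rw [mul_pow, Real.sq_sqrt gaussianSqVar_pos.le]
        ring
      rw [h2]
      have h3 := mul_le_mul_of_nonneg_right h1 (div_nonneg gaussianSqVar_pos.le zero_le_four)
      linarith
  have hg := gaussianSqVar_pos
  have hI : (fisherInfo S ψ).PosDef := by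
    refine PosDef.of_dotProduct_mulVec_pos (fisherInfo_isHermitian _ _) fun {x} hx => ?_
    obtain ⟨W, l, hW, hWH, h1, h2⟩ := key (WithLp.toLp 2 x)
    rw [star_trivial]
    rw [← h1] at h2
    have hx' : 0 < ‖(WithLp.toLp 2 x : Param q)‖ := norm_pos_iff.2 (by simpa using hx)
    have h3 : 0 < F * ‖(WithLp.toLp 2 x : Param q)‖ ^ 2 * (gaussianSqVar / 4) := by positivity
    exact pos_of_mul_pos_right (h3.trans_le h2) (by positivity)
  obtain ⟨v, hv, hchar⟩ := charFun_map_stdScore hψ hS hI t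
  obtain ⟨W, l, hW, hWH, h1, h2⟩ := key v
  rw [hchar, charFun_map_dirScore hψ hW hWH]
  rw [hv] at h1
  have h4 := h N (fun k => √gaussianSqVar * (l k / 2)) ?_
  · rw [← h1] at h4
    simpa using h4
  · intro k
    have hl := abs_diag_le_of_congr hW hWH hs (mul_nonneg hL (norm_nonneg v)) hSs (hSL v) k
    rw [le_div_iff₀ hs] at hl
    refine abs_le_of_sq_le_sq ?_ hδ.le
    rw [← h1] at h2
    have hl2 : (|l k| * s) ^ 2 ≤ (L * ‖v‖) ^ 2 := pow_le_pow_left₀ (by positivity) hl 2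
    rw [mul_pow, sq_abs] at hl2
    rw [mul_pow, Real.sq_sqrt hg.le]
    -- Combine `|l k| ≤ L‖v‖/s` with `F‖v‖² g/4 ≤ K²‖t‖²`, where `g` is `gaussianSqVar`; the factor
    -- `g/4` cancels.
    have h5 : F * s ^ 2 * (gaussianSqVar * (l k / 2) ^ 2) ≤ F * s ^ 2 * δ ^ 2 := by
      calc F * s ^ 2 * (gaussianSqVar * (l k / 2) ^ 2)
          = F * (gaussianSqVar / 4) * (l k ^ 2 * s ^ 2) := by ring
        _ ≤ F * (gaussianSqVar / 4) * (L * ‖v‖) ^ 2 :=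
            mul_le_mul_of_nonneg_left hl2 (by positivity)
        _ = L ^ 2 * (F * ‖v‖ ^ 2 * (gaussianSqVar / 4)) := by ring
        _ ≤ L ^ 2 * (K ^ 2 * ‖t‖ ^ 2) := mul_le_mul_of_nonneg_left h2 (by positivity)
        _ = (L * K * ‖t‖) ^ 2 := by ring
        _ ≤ (δ * s) ^ 2 * F := ht
        _ = F * s ^ 2 * δ ^ 2 := by ring
    exact le_of_mul_le_mul_left h5 (by positivity)

/-! ### Bounds for `Ψ₁` and for Gram matrices -/

theorem Psi1_transpose {q : ℕ} (ψ : Param q) : (Psi1 ψ)ᵀ = Psi1 ψ := by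
  ext a b
  simp [Psi1, Sym2.eq_swap]

theorem abs_dotProduct_Psi1_mulVec_le {q : ℕ} (v : Param q) (y : Fin q → ℝ) :
    |y ⬝ᵥ Psi1 v *ᵥ y| ≤ q * ‖v‖ * (y ⬝ᵥ y) := by
  have h1 : |y ⬝ᵥ Psi1 v *ᵥ y| ≤ ∑ a, ∑ b, ‖v‖ * (|y a| * |y b|) := by
    simp only [dotProduct, mulVec, Finset.mul_sum]
    refine (Finset.abs_sum_le_sum_abs _ _).trans (Finset.sum_le_sum fun a _ =>
      (Finset.abs_sum_le_sum_abs _ _).trans (Finset.sum_le_sum fun b _ => ?_))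
    rw [abs_mul, abs_mul]
    have : |Psi1 v a b| ≤ ‖v‖ := PiLp.norm_apply_le v (some s(a, b))
    nlinarith [mul_le_mul_of_nonneg_right this (mul_nonneg (abs_nonneg (y a)) (abs_nonneg (y b)))]
  have h2 : ∑ a, ∑ b, ‖v‖ * (|y a| * |y b|) = ‖v‖ * (∑ a, |y a|) ^ 2 := by
    rw [pow_two, Finset.sum_mul_sum, Finset.mul_sum]
    exact Finset.sum_congr rfl fun a _ => (Finset.mul_sum _ _ _).symm
  have h3 : (∑ a, |y a|) ^ 2 ≤ q * (y ⬝ᵥ y) := by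
    have h := sq_sum_le_card_mul_sum_sq (s := Finset.univ) (f := fun a => |y a|)
    simpa [sq_abs, dotProduct, pow_two] using h
  rw [h2] at h1
  calc |y ⬝ᵥ Psi1 v *ᵥ y| ≤ ‖v‖ * (∑ a, |y a|) ^ 2 := h1
    _ ≤ ‖v‖ * (q * (y ⬝ᵥ y)) := mul_le_mul_of_nonneg_left h3 (norm_nonneg v)
    _ = q * ‖v‖ * (y ⬝ᵥ y) := by ring

/-- Off-diagonal parameters occur twice in the trace and once in the norm; choosing one ordered pair
for each unordered pair embeds the smaller sum in the larger. -/
theorem norm_sq_le_trace_Psi1_sq {q : ℕ} (v : Param q) :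
    ‖v‖ ^ 2 ≤ (Psi1 v * Psi1 v).trace + errVar v ^ 2 := by
  have h1 : (Psi1 v * Psi1 v).trace = ∑ p : Fin q × Fin q, v (some s(p.1, p.2)) ^ 2 := by
    rw [Fintype.sum_prod_type, trace]
    refine Finset.sum_congr rfl fun a _ => ?_
    rw [diag_apply, mul_apply]
    refine Finset.sum_congr rfl fun b _ => ?_
    simp only [Psi1, of_apply]
    rw [Sym2.eq_swap (a := b), pow_two]
  have hout : ∀ s : Sym2 (Fin q), s((Quot.out s).1, (Quot.out s).2) = s := fun s => Quot.out_eq s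
  have h2 : ∑ s : Sym2 (Fin q), v (some s) ^ 2
      ≤ ∑ p : Fin q × Fin q, v (some s(p.1, p.2)) ^ 2 := by
    have hinj : Function.Injective fun s : Sym2 (Fin q) => Quot.out s := fun s t h => by
      rw [← hout s, ← hout t]
      exact congrArg (fun p : Fin q × Fin q => s(p.1, p.2)) h
    calc ∑ s : Sym2 (Fin q), v (some s) ^ 2
        = ∑ s : Sym2 (Fin q), v (some (s((Quot.out s).1, (Quot.out s).2))) ^ 2 := by simp only [hout]
      _ = ∑ p ∈ Finset.univ.map ⟨_, hinj⟩, v (some s(p.1, p.2)) ^ 2 := by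
          rw [Finset.sum_map]
          rfl
      _ ≤ _ := Finset.sum_le_sum_of_subset_of_nonneg (Finset.subset_univ _)
          fun _ _ _ => sq_nonneg _
  rw [EuclideanSpace.real_norm_sq_eq, Fintype.sum_option, h1, errVar]
  linarith

/-- Diagonalizing relative to the identity makes `W` orthogonal, with eigenvectors of `ZᵀZ` as
columns. -/
theorem gram_bounds_of_eigenvalues {ι κ : Type*} [Fintype ι] [Fintype κ] [DecidableEq κ]
    {Z : Matrix ι κ ℝ} {a b : ℝ}
    (h : ∀ μ, Module.End.HasEigenvalue (Matrix.toLin' (Zᵀ * Z)) μ → a ≤ μ ∧ μ ≤ b)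
    (x : κ → ℝ) :
    a * (x ⬝ᵥ x) ≤ (Z *ᵥ x) ⬝ᵥ (Z *ᵥ x) ∧ (Z *ᵥ x) ⬝ᵥ (Z *ᵥ x) ≤ b * (x ⬝ᵥ x) := by
  obtain ⟨W, l, hW, hWH⟩ := exists_simultaneous_diagonalization (S := 1) (H := Zᵀ * Z)
    PosDef.one (by simp)
  rw [Matrix.mul_one] at hW
  have hWW : W * Wᵀ = 1 := mul_eq_one_comm.1 hW
  have hGW : Zᵀ * Z * W = W * diagonal l := by
    rw [← hWH, ← Matrix.mul_assoc, ← Matrix.mul_assoc, hWW, Matrix.one_mul]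
  have hl : ∀ k, a ≤ l k ∧ l k ≤ b := by
    intro k
    refine h _ (Module.End.hasEigenvalue_of_hasEigenvector (x := W.col k) ⟨?_, ?_⟩)
    · rw [Module.End.mem_eigenspace_iff, toLin'_apply]
      have := congrArg (fun N => Matrix.col N k) hGW
      calc (Zᵀ * Z) *ᵥ W.col k = (Zᵀ * Z * W).col k := rfl
        _ = (W * diagonal l).col k := this
        _ = l k • W.col k := by
          ext i
          simp [mul_comm]
    · intro h0
      have h1 : (Wᵀ * W) k k = W.col k ⬝ᵥ W.col k := rfl
      rw [hW, h0] at h1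
      simp at h1
  have h1 : x ⬝ᵥ x = ∑ k, (Wᵀ *ᵥ x) k ^ 2 := by
    have : x ⬝ᵥ x = x ⬝ᵥ (W * Wᵀ) *ᵥ x := by rw [hWW, one_mulVec]
    rw [this, ← mulVec_mulVec, dotProduct_mulVec, ← mulVec_transpose]
    simp [dotProduct, pow_two]
  have h2 : (Z *ᵥ x) ⬝ᵥ (Z *ᵥ x) = ∑ k, l k * (Wᵀ *ᵥ x) k ^ 2 := by
    have e : Zᵀ * Z = W * (diagonal l * Wᵀ) := by
      rw [← Matrix.mul_assoc, ← hGW, Matrix.mul_assoc, hWW, Matrix.mul_one]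
    have : (Z *ᵥ x) ⬝ᵥ (Z *ᵥ x) = x ⬝ᵥ (Zᵀ * Z) *ᵥ x := by
      rw [← mulVec_mulVec, dotProduct_mulVec x, vecMul_transpose]
    rw [this, e, ← mulVec_mulVec, ← mulVec_mulVec, dotProduct_mulVec x, ← mulVec_transpose]
    simp only [dotProduct, mulVec_diagonal]
    exact Finset.sum_congr rfl fun k _ => by ring
  rw [h1, h2, Finset.mul_sum, Finset.mul_sum]
  exact ⟨Finset.sum_le_sum fun k _ => mul_le_mul_of_nonneg_right (hl k).1 (sq_nonneg _),
    Finset.sum_le_sum fun k _ => mul_le_mul_of_nonneg_right (hl k).2 (sq_nonneg _)⟩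

/-- The Frobenius norm of a single diagonal block of the covariance matrix. -/
theorem le_trace_block_sq {ι κ : Type*} [Fintype ι] [DecidableEq ι] [Fintype κ] [DecidableEq κ]
    [Nonempty κ] {Z : Matrix ι κ ℝ} {Ψ : Matrix κ κ ℝ} (hΨ : Ψᵀ = Ψ) {a θ : ℝ} (ha : 0 ≤ a)
    (hθ : θ ∈ Set.Ioo (0 : ℝ) 1)
    (hZ : ∀ x : κ → ℝ, a * (x ⬝ᵥ x) ≤ (Z *ᵥ x) ⬝ᵥ (Z *ᵥ x)) (x : ℝ) :
    (1 - θ) * (a ^ 2 * (Ψ * Ψ).trace) + x ^ 2 * (Fintype.card ι - Fintype.card κ / θ)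
      ≤ ((Z * Ψ * Zᵀ + x • 1) * (Z * Ψ * Zᵀ + x • 1)).trace := by
  set G := Zᵀ * Z with hG
  have hGp : G.PosSemidef := by
    have := posSemidef_conjTranspose_mul_self Z
    rwa [conjTranspose_eq_transpose_of_trivial] at this
  have hGa : ∀ y : κ → ℝ, a * (y ⬝ᵥ y) ≤ y ⬝ᵥ G *ᵥ y := by
    intro y
    rw [hG, ← mulVec_mulVec, dotProduct_mulVec y, vecMul_transpose]
    exact hZ y
  have h1 := le_trace_mul_mul_mul hΨ hGp ha hGa
  have e1 : (Z * Ψ * Zᵀ * (Z * Ψ * Zᵀ)).trace = (Ψ * G * Ψ * G).trace := by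
    rw [Matrix.mul_assoc Z, Matrix.mul_assoc Z, trace_mul_comm]
    simp only [hG, Matrix.mul_assoc]
  have e2 : (Z * Ψ * Zᵀ).trace = (Ψ * G).trace := by
    rw [Matrix.mul_assoc, trace_mul_comm, Matrix.mul_assoc]
  have h2 : ((Z * Ψ * Zᵀ + x • 1) * (Z * Ψ * Zᵀ + x • 1)).trace
      = (Ψ * G * Ψ * G).trace + 2 * x * (Ψ * G).trace + x ^ 2 * Fintype.card ι := by
    simp only [Matrix.add_mul, Matrix.mul_add, Matrix.smul_mul, Matrix.mul_smul, Matrix.one_mul,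
      Matrix.mul_one, trace_add, trace_smul, smul_eq_mul, e1, e2, trace_one]
    ring
  -- Cauchy–Schwarz on the diagonal of the symmetric matrix `BΨBᵀ`, where `G = BᵀB`.
  have h3 : (Ψ * G).trace ^ 2 ≤ Fintype.card κ * (Ψ * G * Ψ * G).trace := by
    obtain ⟨B, hB⟩ := exists_eq_transpose_mul_self hGp
    set T := B * Ψ * Bᵀ with hT
    have hTt : Tᵀ = T := by
      simp only [hT, transpose_mul, transpose_transpose, hΨ, Matrix.mul_assoc]
    have t1 : (Ψ * G).trace = T.trace := by
      rw [hB, hT, Matrix.mul_assoc B, trace_mul_comm B, Matrix.mul_assoc]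
    have t2 : (Ψ * G * Ψ * G).trace = (Tᵀ * T).trace := by
      rw [hTt, hB, hT, Matrix.mul_assoc B, Matrix.mul_assoc B, trace_mul_comm B]
      simp only [Matrix.mul_assoc]
    rw [t1, t2, trace_transpose_mul_self]
    have h := sq_sum_le_card_mul_sum_sq (s := Finset.univ) (f := fun i => T i i)
    refine h.trans (mul_le_mul_of_nonneg_left (Finset.sum_le_sum fun k _ => ?_) (by positivity))
    rw [pow_two]
    exact Finset.single_le_sum (f := fun i => T.col k i * T.col k i)
      (fun i _ => mul_self_nonneg _) (Finset.mem_univ k)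
  rw [h2]
  set τ := (Ψ * G).trace
  set Q := (Ψ * G * Ψ * G).trace
  have hκ : (0 : ℝ) < Fintype.card κ := by exact_mod_cast Fintype.card_pos
  set k := (Fintype.card κ : ℝ)
  -- As `v` is an arbitrary direction, the cross term `2xτ` may be negative; completing the square
  -- absorbs it into a fraction `θ` of `Q` and a multiple of `x²`.
  have h4 : 0 ≤ θ * Q + 2 * x * τ + x ^ 2 * (k / θ) := by
    have h5 : 0 ≤ (θ * τ + k * x) ^ 2 / (k * θ) :=
      div_nonneg (sq_nonneg _) (mul_nonneg hκ.le hθ.1.le)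
    have h6 : (θ * τ + k * x) ^ 2 / (k * θ) = θ * (τ ^ 2 / k) + 2 * x * τ + x ^ 2 * (k / θ) := by
      have := hθ.1.ne'
      field_simp
      ring
    have h7 : τ ^ 2 / k ≤ Q := by rw [div_le_iff₀ hκ]; linarith
    have h8 := mul_le_mul_of_nonneg_left h7 hθ.1.le
    linarith
  have h9 := mul_le_mul_of_nonneg_left h1 (sub_nonneg.2 hθ.2.le)
  linarith

namespace ClusterDesign

variable {m q : ℕ} (D : ClusterDesign m q)

theorem card_obs : Fintype.card D.Obs = D.n := by
  simp [Obs, n]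

/-! ### The covariance matrix as a linear function of the parameter -/

theorem Sig_eq_blockDiagonal (ψ : Param q) : D.Sig ψ
    = blockDiagonal' fun i => D.Z i * Psi1 ψ * (D.Z i)ᵀ + errVar ψ • 1 := by
  rw [Sig, bigZ, ← blockDiagonal'_mul, blockDiagonal'_transpose, ← blockDiagonal'_mul,
    ← blockDiagonal'_one, ← blockDiagonal'_smul, ← blockDiagonal'_add]
  rfl

/-- `Σ(ψ)` as a linear map. -/
noncomputable def sigLin : Param q →ₗ[ℝ] Matrix D.Obs D.Obs ℝ where
  toFun := D.Sig
  map_add' ψ φ := by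
    have h1 : Psi1 (ψ + φ) = Psi1 ψ + Psi1 φ := by ext; simp [Psi1]
    have h2 : errVar (ψ + φ) = errVar ψ + errVar φ := by simp [errVar]
    simp only [Sig_eq_blockDiagonal, h1, h2, ← blockDiagonal'_add]
    congr 1
    funext i
    simp only [Matrix.mul_add, Matrix.add_mul, add_smul, Pi.add_apply]
    abel
  map_smul' c ψ := by
    have h1 : Psi1 (c • ψ) = c • Psi1 ψ := by ext; simp [Psi1]
    have h2 : errVar (c • ψ) = c * errVar ψ := by simp [errVar]
    simp only [Sig_eq_blockDiagonal, h1, h2, ← blockDiagonal'_smul, RingHom.id_apply]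
    congr 1
    funext i
    simp only [Matrix.mul_smul, Matrix.smul_mul, mul_smul, Pi.smul_apply, smul_add]

/-- `Vᵀ Σ(ψ) V` as a linear map. -/
noncomputable def restrictedSigLin (V : Matrix D.Obs (Fin (D.n - D.p)) ℝ) :
    Param q →ₗ[ℝ] Matrix (Fin (D.n - D.p)) (Fin (D.n - D.p)) ℝ where
  toFun := D.restrictedSig V
  map_add' ψ φ := by
    have : D.Sig (ψ + φ) = D.Sig ψ + D.Sig φ := D.sigLin.map_add ψ φ
    simp only [restrictedSig, this, Matrix.mul_add, Matrix.add_mul]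
  map_smul' c ψ := by
    have : D.Sig (c • ψ) = c • D.Sig ψ := D.sigLin.map_smul c ψ
    simp only [restrictedSig, this, Matrix.mul_smul, Matrix.smul_mul, RingHom.id_apply]

theorem coe_restrictedSigLin (V : Matrix D.Obs (Fin (D.n - D.p)) ℝ) :
    ⇑(D.restrictedSigLin V) = D.restrictedSig V := rfl

theorem Sig_transpose (ψ : Param q) : (D.Sig ψ)ᵀ = D.Sig ψ := by
  rw [Sig_eq_blockDiagonal, blockDiagonal'_transpose]
  congr 1
  funext i
  simp [Psi1_transpose, Matrix.mul_assoc]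

theorem restrictedSig_transpose (V : Matrix D.Obs (Fin (D.n - D.p)) ℝ) (ψ : Param q) :
    (D.restrictedSig V ψ)ᵀ = D.restrictedSig V ψ := by
  simp only [restrictedSig, transpose_mul, transpose_transpose, Sig_transpose, Matrix.mul_assoc]

theorem dotProduct_eq_sum_blocks (x y : D.Obs → ℝ) :
    x ⬝ᵥ y = ∑ i, (fun a => x ⟨i, a⟩) ⬝ᵥ fun a => y ⟨i, a⟩ := by
  simp only [dotProduct]
  exact Fintype.sum_sigma _

theorem blockDiagonal_mulVec (M : ∀ i, Matrix (Fin (D.size i)) (Fin (D.size i)) ℝ)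
    (x : D.Obs → ℝ) (i : Fin m) (a : Fin (D.size i)) :
    (blockDiagonal' M *ᵥ x) ⟨i, a⟩ = (M i *ᵥ fun b => x ⟨i, b⟩) a := by
  simp only [mulVec, dotProduct]
  rw [Fintype.sum_sigma, Finset.sum_eq_single i]
  · simp
  · intro j _ hj
    exact Finset.sum_eq_zero fun b _ => by rw [blockDiagonal'_apply_ne _ _ _ hj.symm, zero_mul]
  · simp

theorem dotProduct_Sig_mulVec (ψ : Param q) (x : D.Obs → ℝ) :
    x ⬝ᵥ D.Sig ψ *ᵥ x
      = ∑ i, (((D.Z i)ᵀ *ᵥ fun a => x ⟨i, a⟩) ⬝ᵥ Psi1 ψ *ᵥ ((D.Z i)ᵀ *ᵥ fun a => x ⟨i, a⟩)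
        + errVar ψ * ((fun a => x ⟨i, a⟩) ⬝ᵥ fun a => x ⟨i, a⟩)) := by
  rw [dotProduct_eq_sum_blocks, Sig_eq_blockDiagonal]
  refine Finset.sum_congr rfl fun i _ => ?_
  simp only [blockDiagonal_mulVec]
  change (fun a => x ⟨i, a⟩) ⬝ᵥ ((D.Z i * Psi1 ψ * (D.Z i)ᵀ + errVar ψ • 1) *ᵥ fun b => x ⟨i, b⟩)
    = _
  rw [add_mulVec, dotProduct_add, smul_mulVec, one_mulVec, dotProduct_smul, smul_eq_mul,
    ← mulVec_mulVec, ← mulVec_mulVec, dotProduct_mulVec _ (D.Z i), ← mulVec_transpose]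

theorem le_dotProduct_Sig_mulVec {ψ : Param q} (hψ : ψ ∈ paramSet q) (x : D.Obs → ℝ) :
    errVar ψ * (x ⬝ᵥ x) ≤ x ⬝ᵥ D.Sig ψ *ᵥ x := by
  rw [dotProduct_Sig_mulVec, dotProduct_eq_sum_blocks, Finset.mul_sum]
  refine Finset.sum_le_sum fun i _ => ?_
  have := hψ.1.dotProduct_mulVec_nonneg ((D.Z i)ᵀ *ᵥ fun a => x ⟨i, a⟩)
  rw [star_trivial] at this
  linarith

theorem abs_dotProduct_Sig_mulVec_le {c : ℝ} (hc : 0 ≤ c)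
    (hZ : ∀ i (x : Fin q → ℝ), (D.Z i *ᵥ x) ⬝ᵥ (D.Z i *ᵥ x) ≤ c * (x ⬝ᵥ x))
    (v : Param q) (x : D.Obs → ℝ) :
    |x ⬝ᵥ D.Sig v *ᵥ x| ≤ (q * c + 1) * ‖v‖ * (x ⬝ᵥ x) := by
  rw [dotProduct_Sig_mulVec, dotProduct_eq_sum_blocks, Finset.mul_sum]
  refine (Finset.abs_sum_le_sum_abs _ _).trans (Finset.sum_le_sum fun i _ => ?_)
  set u : Fin (D.size i) → ℝ := fun a => x ⟨i, a⟩
  have hu : 0 ≤ u ⬝ᵥ u := Finset.sum_nonneg fun _ _ => mul_self_nonneg _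
  have h1 := abs_dotProduct_Psi1_mulVec_le v ((D.Z i)ᵀ *ᵥ u)
  have h2 := transpose_mulVec_dotProduct_le hc (hZ i) u
  have h3 : |errVar v * (u ⬝ᵥ u)| ≤ ‖v‖ * (u ⬝ᵥ u) := by
    rw [abs_mul, abs_of_nonneg hu]
    exact mul_le_mul_of_nonneg_right (PiLp.norm_apply_le v none) hu
  have h4 := mul_le_mul_of_nonneg_left h2 (mul_nonneg (Nat.cast_nonneg q) (norm_nonneg v))
  refine (abs_add_le _ _).trans ?_
  linarith

theorem le_trace_Sig_sq (hq : 1 ≤ q) {c₁ c₂ : ℝ} (hc₁ : 1 < c₁) (hc₂ : 0 < c₂)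
    (hn : c₁ * q * m ≤ D.n)
    (hZ : ∀ i (x : Fin q → ℝ), c₂⁻¹ * (x ⬝ᵥ x) ≤ (D.Z i *ᵥ x) ⬝ᵥ (D.Z i *ᵥ x)) (v : Param q) :
    m * min ((1 - 2 / (1 + c₁)) * c₂⁻¹ ^ 2) ((c₁ - 1) / 2) * ‖v‖ ^ 2
      ≤ (D.Sig v * D.Sig v).trace := by
  have : Nonempty (Fin q) := ⟨⟨0, hq⟩⟩
  -- With this `θ`, `q/θ` is the midpoint of `q` and `c₁q`, so `n - mq/θ ≥ mq(c₁ - 1)/2` while `1 -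
  -- θ` stays positive.
  have hθ : 2 / (1 + c₁) ∈ Set.Ioo (0 : ℝ) 1 :=
    ⟨by positivity, by rw [div_lt_one (by positivity)]; linarith⟩
  rw [Sig_eq_blockDiagonal, ← blockDiagonal'_mul, trace_blockDiagonal']
  have h1 := Finset.sum_le_sum fun i (_ : i ∈ (Finset.univ : Finset (Fin m))) =>
    le_trace_block_sq (Psi1_transpose v) (inv_nonneg.2 hc₂.le) hθ (hZ i) (errVar v)
  refine le_trans ?_ h1
  simp only [Fintype.card_fin]
  rw [Finset.sum_add_distrib, Finset.sum_const, Finset.card_univ, Fintype.card_fin, nsmul_eq_mul,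
    ← Finset.mul_sum, Finset.sum_sub_distrib, Finset.sum_const, Finset.card_univ, Fintype.card_fin,
    nsmul_eq_mul]
  have hsz : ∑ i, (D.size i : ℝ) = D.n := by
    rw [n]
    push_cast
    rfl
  rw [hsz]
  set κ := min ((1 - 2 / (1 + c₁)) * c₂⁻¹ ^ 2) ((c₁ - 1) / 2)
  have hκ1 : κ ≤ (1 - 2 / (1 + c₁)) * c₂⁻¹ ^ 2 := min_le_left _ _
  have hκ2 : κ ≤ (c₁ - 1) / 2 := min_le_right _ _
  have hκ0 : 0 ≤ κ := le_min (mul_nonneg (sub_nonneg.2 hθ.2.le) (by positivity)) (by linarith)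
  have hm : (0 : ℝ) ≤ m := Nat.cast_nonneg m
  have hP : 0 ≤ (Psi1 v * Psi1 v).trace := by
    have := trace_transpose_mul_self_nonneg (Psi1 v)
    rwa [Psi1_transpose] at this
  have hq' : (1 : ℝ) ≤ q := by exact_mod_cast hq
  have h2 : m * κ ≤ D.n - m * (q / (2 / (1 + c₁))) := by
    have e : (q : ℝ) / (2 / (1 + c₁)) = q * (1 + c₁) / 2 := by
      field_simp
    rw [e]
    have h3 : m * κ ≤ m * (q * ((c₁ - 1) / 2)) := by
      refine mul_le_mul_of_nonneg_left (hκ2.trans ?_) hm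
      exact le_mul_of_one_le_left (by linarith) hq'
    linarith
  calc m * κ * ‖v‖ ^ 2 ≤ m * κ * ((Psi1 v * Psi1 v).trace + errVar v ^ 2) :=
        mul_le_mul_of_nonneg_left (norm_sq_le_trace_Psi1_sq v) (mul_nonneg hm hκ0)
    _ = m * (κ * (Psi1 v * Psi1 v).trace) + errVar v ^ 2 * (m * κ) := by ring
    _ ≤ _ := by
        refine add_le_add (mul_le_mul_of_nonneg_left ?_ hm)
          (mul_le_mul_of_nonneg_left h2 (sq_nonneg _))
        rw [← mul_assoc]
        exact mul_le_mul_of_nonneg_right hκ1 hP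

/-! ### Restricted data -/

variable {D} {V : Matrix D.Obs (Fin (D.n - D.p)) ℝ}

theorem dotProduct_restrictedSig_mulVec (ψ : Param q) (x : Fin (D.n - D.p) → ℝ) :
    x ⬝ᵥ D.restrictedSig V ψ *ᵥ x = (V *ᵥ x) ⬝ᵥ D.Sig ψ *ᵥ (V *ᵥ x) := by
  rw [restrictedSig, ← mulVec_mulVec, ← mulVec_mulVec, dotProduct_mulVec x, vecMul_transpose]

theorem IsRestriction.dotProduct_mulVec_mulVec (hV : D.IsRestriction V) (x : Fin (D.n - D.p) → ℝ) :
    (V *ᵥ x) ⬝ᵥ (V *ᵥ x) = x ⬝ᵥ x := by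
  rw [← vecMul_transpose V x, ← Matrix.dotProduct_mulVec, vecMul_transpose, mulVec_mulVec, hV.1,
    one_mulVec]

theorem IsRestriction.le_trace_restrictedSig_sq (hV : D.IsRestriction V) {c L : ℝ} (hL : 0 ≤ L)
    (hL' : ∀ v (x : D.Obs → ℝ), |x ⬝ᵥ D.Sig v *ᵥ x| ≤ L * ‖v‖ * (x ⬝ᵥ x))
    (hc : ∀ v, c * ‖v‖ ^ 2 ≤ (D.Sig v * D.Sig v).trace) (v : Param q) :
    (c - 2 * L ^ 2 * D.p) * ‖v‖ ^ 2 ≤ (D.restrictedSig V v * D.restrictedSig V v).trace := by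
  have h := le_trace_compression_sq (D.Sig_transpose v) (mul_nonneg hL (norm_nonneg v)) (hL' v)
    hV.1
  refine le_trans ?_ h
  rw [card_obs, Fintype.card_fin]
  -- The subtraction in the index type is truncated, but this inequality holds whether or not `p ≤
  -- n`.
  have hp : (D.n : ℝ) - ((D.n - D.p : ℕ) : ℝ) ≤ D.p := by
    rw [sub_le_iff_le_add]
    exact_mod_cast (by omega : D.n ≤ D.p + (D.n - D.p))
  have h1 := mul_le_mul_of_nonneg_left hp (by positivity : 0 ≤ 2 * (L * ‖v‖) ^ 2)
  have h2 := hc v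
  nlinarith

theorem measurable_response (D : ClusterDesign m q) (β : Fin D.p → ℝ) :
    Measurable (D.response β) := by
  refine measurable_pi_lambda _ fun o => ?_
  have : Continuous fun ω : (Fin m → EuclideanSpace ℝ (Fin q)) ×
      (∀ i, EuclideanSpace ℝ (Fin (D.size i))) => D.response β ω o := by
    unfold response
    fun_prop
  exact this.measurable

/-- With `u = Vt`, the fixed effects vanish from the inner product with `t`, and independence
factors the characteristic function into Gaussian ones at `Zᵢᵀuᵢ` and `uᵢ`. -/
theorem IsRestriction.map_responseLaw (hV : D.IsRestriction V) (β : Fin D.p → ℝ) {ψ : Param q}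
    (hψ : ψ ∈ paramSet q) :
    (D.responseLaw β ψ).map (fun y => WithLp.toLp 2 (Vᵀ *ᵥ y))
      = multivariateGaussian 0 (D.restrictedSig V ψ) := by
  have hE : ∀ i, (errVar ψ • (1 : Matrix (Fin (D.size i)) (Fin (D.size i)) ℝ)).PosSemidef :=
    fun i => PosSemidef.one.smul hψ.2.le
  have hS : (D.restrictedSig V ψ).PosSemidef := by
    refine PosSemidef.of_dotProduct_mulVec_nonneg ?_ fun x => ?_
    · rw [IsHermitian, conjTranspose_eq_transpose_of_trivial, restrictedSig_transpose]
    · rw [star_trivial, dotProduct_restrictedSig_mulVec]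
      refine le_trans (mul_nonneg hψ.2.le ?_) (D.le_dotProduct_Sig_mulVec hψ _)
      exact Finset.sum_nonneg fun _ _ => mul_self_nonneg _
  have hr := D.measurable_response β
  have hT : Measurable fun y : D.Obs → ℝ => WithLp.toLp 2 (Vᵀ *ᵥ y) := by
    have : Continuous fun y : D.Obs → ℝ => WithLp.toLp 2 (Vᵀ *ᵥ y) := by fun_prop
    exact this.measurable
  have hprob : IsProbabilityMeasure (D.effectsLaw ψ) := by
    unfold effectsLaw
    infer_instance
  rw [responseLaw, Measure.map_map hT hr]
  have := Measure.isProbabilityMeasure_map (μ := D.effectsLaw ψ) (hT.comp hr).aemeasurable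
  refine Measure.ext_of_charFun (funext fun t => ?_)
  set u : D.Obs → ℝ := V *ᵥ t.ofLp with hu
  have hX : u ⬝ᵥ (D.stackX *ᵥ β) = 0 := by
    rw [dotProduct_mulVec, hu, ← vecMul_transpose, vecMul_vecMul, hV.2]
    simp
  have hinner : ∀ ω, inner ℝ (WithLp.toLp 2 (Vᵀ *ᵥ D.response β ω)) t
      = ∑ i, inner ℝ (ω.1 i) (WithLp.toLp 2 ((D.Z i)ᵀ *ᵥ fun a => u ⟨i, a⟩))
        + ∑ i, inner ℝ (ω.2 i) (WithLp.toLp 2 fun a => u ⟨i, a⟩) := by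
    intro ω
    have h1 : inner ℝ (WithLp.toLp 2 (Vᵀ *ᵥ D.response β ω)) t = u ⬝ᵥ D.response β ω := by
      rw [EuclideanSpace.inner_eq_star_dotProduct, star_trivial, hu, dotProduct_mulVec,
        vecMul_transpose]
    have h2 : D.response β ω = D.stackX *ᵥ β + ((fun o => (D.Z o.1 *ᵥ (ω.1 o.1).ofLp) o.2)
        + fun o => ω.2 o.1 o.2) := by
      funext o
      simp only [response, Pi.add_apply, ← add_assoc]
      rfl
    rw [h1, h2, dotProduct_add, hX, zero_add, dotProduct_add, dotProduct_eq_sum_blocks,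
      dotProduct_eq_sum_blocks]
    congr 1
    · refine Finset.sum_congr rfl fun i _ => ?_
      rw [EuclideanSpace.inner_eq_star_dotProduct, star_trivial]
      simp only
      rw [mulVec_transpose, ← dotProduct_mulVec]
  rw [charFun_apply, integral_map (hT.comp hr).aemeasurable (by fun_prop)]
  simp only [Function.comp_apply, hinner]
  have hsplit : ∀ ω : (Fin m → EuclideanSpace ℝ (Fin q)) ×
      (∀ i, EuclideanSpace ℝ (Fin (D.size i))),
      Complex.exp (((∑ i, inner ℝ (ω.1 i) (WithLp.toLp 2 ((D.Z i)ᵀ *ᵥ fun a => u ⟨i, a⟩))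
        + ∑ i, inner ℝ (ω.2 i) (WithLp.toLp 2 fun a => u ⟨i, a⟩) : ℝ) : ℂ) * Complex.I)
      = (∏ i, Complex.exp ((inner ℝ (ω.1 i)
          (WithLp.toLp 2 ((D.Z i)ᵀ *ᵥ fun a => u ⟨i, a⟩)) : ℝ) * Complex.I))
        * ∏ i, Complex.exp ((inner ℝ (ω.2 i) (WithLp.toLp 2 fun a => u ⟨i, a⟩) : ℝ)
          * Complex.I) := by
    intro ω
    rw [← Complex.exp_sum, ← Complex.exp_sum, ← Complex.exp_add, ← Finset.sum_mul,
      ← Finset.sum_mul, ← add_mul]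
    push_cast
    rfl
  simp only [hsplit]
  rw [effectsLaw, integral_prod_mul
    (f := fun ω₁ : Fin m → EuclideanSpace ℝ (Fin q) => ∏ i, Complex.exp ((inner ℝ (ω₁ i)
      (WithLp.toLp 2 ((D.Z i)ᵀ *ᵥ fun a => u ⟨i, a⟩)) : ℝ) * Complex.I))
    (g := fun ω₂ : ∀ i, EuclideanSpace ℝ (Fin (D.size i)) => ∏ i, Complex.exp ((inner ℝ (ω₂ i)
      (WithLp.toLp 2 fun a => u ⟨i, a⟩) : ℝ) * Complex.I)),
    integral_fintype_prod_eq_prod (f := fun i (x : EuclideanSpace ℝ (Fin q)) =>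
      Complex.exp ((inner ℝ x (WithLp.toLp 2 ((D.Z i)ᵀ *ᵥ fun a => u ⟨i, a⟩)) : ℝ) * Complex.I)),
    integral_fintype_prod_eq_prod (f := fun i (x : EuclideanSpace ℝ (Fin (D.size i))) =>
      Complex.exp ((inner ℝ x (WithLp.toLp 2 fun a => u ⟨i, a⟩) : ℝ) * Complex.I))]
  simp only [← charFun_apply]
  simp only [charFun_multivariateGaussian hψ.1, charFun_multivariateGaussian (hE _),
    charFun_multivariateGaussian hS, inner_zero_right, Complex.ofReal_zero, zero_mul, zero_sub,
    ← Complex.exp_sum, ← Complex.exp_add]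
  congr 1
  rw [dotProduct_restrictedSig_mulVec, ← hu, dotProduct_Sig_mulVec, Finset.sum_add_distrib]
  simp only [smul_mulVec, one_mulVec, dotProduct_smul, smul_eq_mul]
  push_cast
  rw [Finset.sum_neg_distrib, Finset.sum_neg_distrib, add_div, Finset.sum_div, Finset.sum_div]
  ring

end ClusterDesign

/-! ### Coverage of the restricted score region -/

namespace ClusterDesign

variable {m q : ℕ} {D : ClusterDesign m q} {V : Matrix D.Obs (Fin (D.n - D.p)) ℝ}

theorem IsRestriction.posDef_restrictedSig (hV : D.IsRestriction V) {ψ : Param q}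
    (hψ : ψ ∈ paramSet q) : (D.restrictedSig V ψ).PosDef := by
  refine PosDef.of_dotProduct_mulVec_pos ?_ fun {x} hx => ?_
  · rw [IsHermitian, conjTranspose_eq_transpose_of_trivial, restrictedSig_transpose]
  · rw [star_trivial, dotProduct_restrictedSig_mulVec]
    refine lt_of_lt_of_le (mul_pos hψ.2 ?_) (D.le_dotProduct_Sig_mulVec hψ _)
    rw [hV.dotProduct_mulVec_mulVec]
    exact lt_of_le_of_ne (Finset.sum_nonneg fun i _ => mul_self_nonneg _)
      fun h0 => hx (dotProduct_self_eq_zero.1 h0.symm)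

theorem IsRestriction.measurable_stdScore (hV : D.IsRestriction V) {ψ : Param q}
    (hψ : ψ ∈ paramSet q) :
    Measurable fun y : Fin (D.n - D.p) → ℝ => stdScore (D.restrictedSig V) ψ y :=
  ClusterMixed.measurable_stdScore (S := D.restrictedSigLin V) (hV.posDef_restrictedSig hψ)
    (D.restrictedSig_transpose V)

theorem IsRestriction.coverage_eq (hV : D.IsRestriction V) (α : ℝ) (β : Fin D.p → ℝ)
    {ψ : Param q} (hψ : ψ ∈ paramSet q) :
    D.coverage V α β ψ = ((multivariateGaussian 0 (D.restrictedSig V ψ)).map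
      (fun y => stdScore (D.restrictedSig V) ψ y.ofLp)).real
        {w | ‖w‖ ^ 2 ≤ chiSqQuantile (paramDim q) (1 - α)} := by
  have hT : Measurable fun y : D.Obs → ℝ => WithLp.toLp 2 (Vᵀ *ᵥ y) := by
    have : Continuous fun y : D.Obs → ℝ => WithLp.toLp 2 (Vᵀ *ᵥ y) := by fun_prop
    exact this.measurable
  have hst : Measurable fun y : EuclideanSpace ℝ (Fin (D.n - D.p)) =>
      stdScore (D.restrictedSig V) ψ y.ofLp :=
    (hV.measurable_stdScore hψ).comp (by fun_prop)
  have hset : MeasurableSet {w : Param q | ‖w‖ ^ 2 ≤ chiSqQuantile (paramDim q) (1 - α)} :=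
    (isClosed_le (by fun_prop) continuous_const).measurableSet
  rw [← hV.map_responseLaw β hψ, Measure.map_map hst hT, map_measureReal_apply (hst.comp hT) hset,
    coverage]
  congr 1
  ext y
  simp [restrictedRegion, restrictedScoreStat, scoreStat, hψ]

end ClusterDesign

/-! ### Uniformity over compact sets and the limit along sequences -/

theorem exists_bounds_of_isCompact {q : ℕ} {A : Set (Param q)} (hA : IsCompact A)
    (hAP : A ⊆ paramSet q) :
    ∃ s > 0, ∃ R > 0, ∀ ψ ∈ A, s ≤ errVar ψ ∧ ‖ψ‖ ≤ R := by
  obtain ⟨R, hR⟩ := hA.isBounded.exists_pos_norm_le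
  rcases A.eq_empty_or_nonempty with rfl | hne
  · exact ⟨1, one_pos, 1, one_pos, by simp⟩
  · have hc : Continuous fun ψ : Param q => errVar ψ := by
      unfold errVar
      fun_prop
    obtain ⟨ψ₀, hψ₀, hmin⟩ := hA.exists_isMinOn hne hc.continuousOn
    exact ⟨errVar ψ₀, (hAP hψ₀).2, R, hR.1, fun ψ hψ => ⟨hmin hψ, hR.2 ψ hψ⟩⟩

/-- A supremum of nonnegative bounded functions tends to zero as soon as the functions do along
every choice of arguments. -/
theorem tendsto_iSup_of_forall_tendsto {ι : Type*} [Nonempty ι] {f : ℕ → ι → ℝ}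
    (h0 : ∀ m i, 0 ≤ f m i) (hb : ∀ m, BddAbove (Set.range (f m)))
    (h : ∀ x : ℕ → ι, Tendsto (fun m => f m (x m)) atTop (𝓝 0)) :
    Tendsto (fun m => ⨆ i, f m i) atTop (𝓝 0) := by
  have hex : ∀ m : ℕ, ∃ i, (⨆ i, f m i) - 1 / ((m : ℝ) + 1) < f m i := fun m =>
    exists_lt_of_lt_ciSup (sub_lt_self _ (by positivity))
  choose x hx using hex
  have h1 := (h x).add tendsto_one_div_add_atTop_nhds_zero_nat
  rw [add_zero] at h1
  refine squeeze_zero (fun m => ?_) (fun m => ?_) h1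
  · exact (h0 m (x m)).trans (le_ciSup (hb m) (x m))
  · linarith [hx m]

/-- Asymptotic normality of the standardized restricted score along a bounded sequence of
parameters with error variance bounded below. -/
theorem tendsto_charFun_stdScore {q : ℕ} (hq : 1 ≤ q) (D : ∀ m : ℕ, ClusterDesign m q)
    (V : ∀ m : ℕ, Matrix (D m).Obs (Fin ((D m).n - (D m).p)) ℝ)
    (hV : ∀ m, 1 ≤ m → (D m).IsRestriction (V m)) {c₁ c₂ : ℝ} (hc₁ : 1 < c₁) (hc₂ : 0 < c₂)
    (hn : ∀ m, 1 ≤ m → c₁ * q * m ≤ (D m).n)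
    (hZ : ∀ m, 1 ≤ m → ∀ i (x : Fin q → ℝ),
      c₂⁻¹ * (x ⬝ᵥ x) ≤ ((D m).Z i *ᵥ x) ⬝ᵥ ((D m).Z i *ᵥ x) ∧
        ((D m).Z i *ᵥ x) ⬝ᵥ ((D m).Z i *ᵥ x) ≤ c₂ * (x ⬝ᵥ x))
    (hp : Tendsto (fun m : ℕ => ((D m).p : ℝ) / (m : ℝ)) atTop (𝓝 0))
    {s R : ℝ} (hs : 0 < s) (hR : 0 < R) {ψ : ℕ → Param q}
    (hψ : ∀ m, ψ m ∈ paramSet q ∧ s ≤ errVar (ψ m) ∧ ‖ψ m‖ ≤ R) (t : Param q) :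
    Tendsto (fun m => charFun ((multivariateGaussian 0 ((D m).restrictedSig (V m) (ψ m))).map
      (fun y => stdScore ((D m).restrictedSig (V m)) (ψ m) y.ofLp)) t) atTop
      (𝓝 (Complex.exp (-‖t‖ ^ 2 / 2))) := by
  set L : ℝ := q * c₂ + 1 with hL
  have hL0 : 0 < L := by positivity
  set c := min ((1 - 2 / (1 + c₁)) * c₂⁻¹ ^ 2) ((c₁ - 1) / 2) with hc
  have hc0 : 0 < c := by
    have : 2 / (1 + c₁) < 1 := by rw [div_lt_one (by positivity)]; linarith
    exact lt_min (mul_pos (by linarith) (by positivity)) (by linarith)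
  rw [Metric.tendsto_atTop]
  intro ε hε
  obtain ⟨δ, hδ, h⟩ := norm_charFun_stdScore_sub_le
    (show 0 < ε / (‖t‖ ^ 2 + 1) by positivity)
  -- This threshold makes the restriction loss `2L²p` at most `mc/2`, leaving at least `mc/2` of the
  -- trace bound.
  have h1 : ∀ᶠ m : ℕ in atTop, ((D m).p : ℝ) / m < c / (4 * L ^ 2) :=
    hp.eventually (gt_mem_nhds (by positivity))
  have h2 : ∀ᶠ m : ℕ in atTop, (L * (L * R) * ‖t‖) ^ 2 ≤ (δ * s) ^ 2 * (c / 2) * (m : ℝ) :=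
    (tendsto_natCast_atTop_atTop.const_mul_atTop
      (show 0 < (δ * s) ^ 2 * (c / 2) by positivity)).eventually_ge_atTop _
  obtain ⟨M, hM⟩ := eventually_atTop.1 ((h1.and h2).and (eventually_ge_atTop 1))
  refine ⟨M, fun m hm => ?_⟩
  obtain ⟨⟨hm1, hm2⟩, hm0⟩ := hM m hm
  obtain ⟨hψP, hψs, hψR⟩ := hψ m
  have hmpos : (0 : ℝ) < m := by exact_mod_cast hm0
  have hVm := hV m hm0
  have hbound := (D m).abs_dotProduct_Sig_mulVec_le hc₂.le fun i x => (hZ m hm0 i x).2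
  have htrace := (D m).le_trace_Sig_sq hq hc₁ hc₂ (hn m hm0) fun i x => (hZ m hm0 i x).1
  have hF : m * (c / 2) ≤ m * c - 2 * L ^ 2 * (D m).p := by
    rw [div_lt_div_iff₀ hmpos (by positivity)] at hm1
    linarith
  have hnn : ∀ x : Fin ((D m).n - (D m).p) → ℝ, 0 ≤ x ⬝ᵥ x := fun x =>
    Finset.sum_nonneg fun _ _ => mul_self_nonneg _
  have h3 := h q _ ((D m).restrictedSigLin (V m)) (ψ m) s (L * R) L (m * c - 2 * L ^ 2 * (D m).p)
    ((D m).restrictedSig_transpose (V m)) hs (by positivity) hL0.le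
    (lt_of_lt_of_le (by positivity) hF) ?_ ?_ ?_
    (hVm.le_trace_restrictedSig_sq hL0.le hbound htrace) t ?_
  · rw [dist_eq_norm]
    refine lt_of_le_of_lt h3 ?_
    rw [div_mul_eq_mul_div, div_lt_iff₀ (by positivity)]
    nlinarith
  · intro x
    rw [(D m).coe_restrictedSigLin, ClusterDesign.dotProduct_restrictedSig_mulVec]
    refine le_trans ?_ ((D m).le_dotProduct_Sig_mulVec hψP _)
    rw [hVm.dotProduct_mulVec_mulVec]
    exact mul_le_mul_of_nonneg_right hψs (hnn x)
  · intro x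
    rw [(D m).coe_restrictedSigLin, ClusterDesign.dotProduct_restrictedSig_mulVec]
    refine (le_abs_self _).trans ((hbound (ψ m) _).trans ?_)
    rw [hVm.dotProduct_mulVec_mulVec]
    exact mul_le_mul_of_nonneg_right (mul_le_mul_of_nonneg_left hψR hL0.le) (hnn x)
  · intro v x
    rw [(D m).coe_restrictedSigLin, ClusterDesign.dotProduct_restrictedSig_mulVec]
    refine (hbound v _).trans_eq ?_
    rw [hVm.dotProduct_mulVec_mulVec]
  · refine hm2.trans ?_
    rw [mul_assoc]
    refine mul_le_mul_of_nonneg_left ?_ (by positivity)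
    linarith

end ClusterMixed

theorem corollary3 {q : ℕ} (hq : 1 ≤ q)
    (D : ∀ m : ℕ, ClusterDesign m q)
    (β : ∀ m : ℕ, Fin (D m).p → ℝ)
    (V : ∀ m : ℕ, Matrix (D m).Obs (Fin ((D m).n - (D m).p)) ℝ)
    (hV : ∀ m, 1 ≤ m → (D m).IsRestriction (V m))
    {c₁ c₂ : ℝ} (hc₁ : 1 < c₁) (hc₂ : 1 < c₂)
    (h_i : ∀ m, 1 ≤ m → c₁ ≤ (D m).avgSize / (q : ℝ))
    (h_ii : ∀ m, 1 ≤ m → ∀ (i : Fin m) (μ : ℝ),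
      Module.End.HasEigenvalue (Matrix.toLin' (((D m).Z i)ᵀ * (D m).Z i)) μ →
        c₂⁻¹ ≤ μ ∧ μ ≤ c₂)
    (h_iii : Tendsto (fun m : ℕ => ((D m).p : ℝ) / (m : ℝ)) atTop (𝓝 0))
    (h_iv : ∀ m, 1 ≤ m → (D m).stackX.rank = (D m).p)
    {α : ℝ} (hα : α ∈ Set.Ioo (0 : ℝ) 1)
    {A : Set (Param q)} (hA : IsCompact A) (hAP : A ⊆ paramSet q) :
    Tendsto (fun m : ℕ => ⨆ ψ : A, |(D m).coverage (V m) α (β m) ψ - (1 - α)|)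
      atTop (𝓝 0) := by
  rcases A.eq_empty_or_nonempty with rfl | hne
  · simp
  have := hne.to_subtype
  obtain ⟨s, hs, R, hR, hsR⟩ := exists_bounds_of_isCompact hA hAP
  have hc₂0 : 0 < c₂ := one_pos.trans hc₂
  have hn : ∀ m, 1 ≤ m → c₁ * q * m ≤ (D m).n := by
    intro m hm
    have hm' : (0 : ℝ) < m := by exact_mod_cast hm
    have hq' : (0 : ℝ) < q := by exact_mod_cast hq
    have h := h_i m hm
    rwa [ClusterDesign.avgSize, le_div_iff₀ hq', le_div_iff₀ hm'] at h
  have hZ := fun m hm i => gram_bounds_of_eigenvalues (h_ii m hm i)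
  have hprob : ∀ m (ψ : Param q), IsProbabilityMeasure ((D m).responseLaw (β m) ψ) := by
    intro m ψ
    have : IsProbabilityMeasure ((D m).effectsLaw ψ) := by
      unfold ClusterDesign.effectsLaw
      infer_instance
    exact Measure.isProbabilityMeasure_map ((D m).measurable_response (β m)).aemeasurable
  refine tendsto_iSup_of_forall_tendsto (fun _ _ => abs_nonneg _) (fun m => ?_) fun x => ?_
  · refine ⟨2, ?_⟩
    rintro _ ⟨ψ, rfl⟩
    have h1 : 0 ≤ (D m).coverage (V m) α (β m) ψ := measureReal_nonneg
    have := hprob m ψ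
    have h2 : (D m).coverage (V m) α (β m) ψ ≤ 1 := measureReal_le_one
    exact abs_le.2 ⟨by linarith [hα.1], by linarith [hα.2]⟩
  · have hchar := tendsto_charFun_stdScore hq D V hV hc₁ hc₂0 hn hZ h_iii hs hR
      (ψ := fun m => x m) (fun m => ⟨hAP (x m).2, hsR _ (x m).2⟩)
    -- The design at `m = 0` is unconstrained, so the sequence is shifted by one to make every term
    -- satisfy the hypotheses.
    have hlim := tendsto_measureReal_normSq_le_quantile hα _
      (fun m => Measure.isProbabilityMeasure_map
        (((hV (m + 1) (by omega)).measurable_stdScore (hAP (x (m + 1)).2)).comp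
          (by fun_prop)).aemeasurable)
      fun t => (hchar t).comp (tendsto_add_atTop_nat 1)
    rw [← tendsto_add_atTop_iff_nat 1, ← abs_zero, ← sub_self (1 - α)]
    refine ((hlim.sub_const (1 - α)).abs).congr fun m => ?_
    rw [(hV (m + 1) (by omega)).coverage_eq α (β (m + 1)) (hAP (x (m + 1)).2)]
    rfl
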